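/- Let $p>0$ and, for $x>1$, put $$g(x)=\frac{(x-1)^{2x-1}\,e^{-\left(\frac1p+2\ln p\right)x+\frac1p}}{x\,\Gamma(2x)} .$$ Write $\Gamma(k,\theta)$ for the Gamma distribution with shape $k$ and scale $\theta$, i.e. with density $x^{k-1}e^{-x/\theta}/(\Gamma(k)\theta^k)$ on $(0,\infty)$. (1) Let $(X_n)_{n\ge 0}$ be the Gamma branching process: $X_0=1$ almost surely and, for every $n\ge 0$, conditionally on $X_0,\dots,X_n$ the variable $X_{n+1}$ has distribution $\Gamma(2X_n,p)$. Let $Z=\sum_{k=0}^\infty X_k\in[0,\infty]$ be the total progeny. Then $Z$ has the (possibly defective) density $g$ on $(1,\infty)$: for every Borel set $B\subseteq\mathbb R$, $$\mathbf P(Z<\infty,\ Z\in B)=\int_{B\cap(1,\infty)} g(x)\,dx .$$ (2) For $0<\delta<p$ put $r^*=\frac{2\delta p}{p-\delta}$ and $q^*=\frac{p-\delta}{p}$. Consider the discrete (Galton--Watson) branching process started from $m$ individuals in which all individuals independently have $k$ children with the negative binomial probability $\frac{\Gamma(k+r^*)}{k!\,\Gamma(r^*)}(1-q^*)^{r^*}(q^*)^k$,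 $k=0,1,2,\dots$, and let $Z_\delta(m)\in\{0,1,2,\dots\}\cup\{\infty\}$ be the total number of individuals in all generations (including the initial one). Then for all integers $n\ge m\ge1$ $$\mathbf P\{Z_\delta(m)=n\}=\frac mn\,\frac{\Gamma(n(1+r^*)-m)}{\Gamma(nr^*)\,\Gamma(n-m+1)}\,(1-q^*)^{r^*n}\,(q^*)^{n-m}.$$ (3) $g$ is the continuum limit of these laws: for every $x>1$, with mesh $\delta=1/m$, $$\lim_{m\to\infty} m\,\mathbf P\{Z_{1/m}(m)=\lfloor mx\rfloor\}=g(x).$$ -/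

import Mathlib

open MeasureTheory ProbabilityTheory Filter Topology Set
open scoped ENNReal Nat

noncomputable section

namespace GammaCascade

/-! ### The Gamma branching process -/

/-- The Gamma distribution with shape `k` and scale `θ`, of density
`x ^ (k - 1) * exp (-x / θ) / (Γ(k) * θ ^ k)` on `(0, ∞)`
(Mathlib's `gammaMeasure` is parametrized by the rate `1 / θ`). For the degenerate shape `k = 0`
(the empty convolution power) it is the point mass at `0`; negative shapes do not occur. -/
def gammaLaw (k θ : ℝ) : Measure ℝ :=
  if 0 < k then gammaMeasure k (1 / θ) else Measure.dirac 0

lemma measurable_realGamma : Measurable Real.Gamma :=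
  measurable_of_tendsto_metrizable (f := fun n s => Real.GammaSeq s n)
    (fun n => by unfold Real.GammaSeq; fun_prop)
    (tendsto_pi_nhds.2 fun s => Real.GammaSeq_tendsto_Gamma s)

lemma measurable_gammaPDF_uncurry (r : ℝ) :
    Measurable (fun z : ℝ × ℝ => gammaPDF z.1 r z.2) := by
  have hG := measurable_realGamma
  unfold gammaPDF gammaPDFReal
  refine ENNReal.measurable_ofReal.comp (Measurable.ite ?_ ?_ measurable_const)
  · exact measurableSet_le measurable_const measurable_snd
  · fun_prop

lemma measurable_gammaLaw (θ : ℝ) : Measurable (fun k => gammaLaw k θ) := by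
  refine Measurable.ite measurableSet_Ioi ?_ measurable_const
  refine Measure.measurable_of_measurable_coe _ fun s hs => ?_
  simp_rw [gammaMeasure, withDensity_apply _ hs]
  exact (measurable_gammaPDF_uncurry (1 / θ)).lintegral_prod_right'

/-- The transition kernel `x ↦ Γ(2x, p)`, applied to the last entry of a history `(x₀, …, xₙ)`. -/
def gammaStep (p : ℝ) (n : ℕ) : Kernel (Fin (n + 1) → ℝ) ℝ where
  toFun x := gammaLaw (2 * x (Fin.last n)) p
  measurable' := (measurable_gammaLaw p).comp ((measurable_pi_apply _).const_mul 2)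

lemma isMarkovKernel_gammaStep {p : ℝ} (hp : 0 < p) (n : ℕ) : IsMarkovKernel (gammaStep p n) := by
  refine ⟨fun x => ?_⟩
  change IsProbabilityMeasure (gammaLaw _ p)
  unfold gammaLaw
  split_ifs with h
  · exact isProbabilityMeasure_gammaMeasure h (by positivity)
  · infer_instance

/-- `X` is a Gamma branching process with scale `p`: it starts from `X₀ = 1` and, conditionally
on the generations `X₀, …, Xₙ`, the size `Xₙ₊₁` has the distribution `Γ(2 Xₙ, p)`. -/
structure IsGammaBranchingProcess {Ω : Type*} [MeasurableSpace Ω] (p : ℝ) (X : ℕ → Ω → ℝ)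
    (P : Measure Ω) : Prop where
  measurable : ∀ n, Measurable (X n)
  start : ∀ᵐ ω ∂P, X 0 ω = 1
  step : ∀ n, HasCondDistrib (X (n + 1)) (fun ω (i : Fin (n + 1)) => X i ω) (gammaStep p n) P

/-- The total cascade size `Z = X₀ + X₁ + ⋯`, which may be infinite. -/
def cascadeSize {Ω : Type*} (X : ℕ → Ω → ℝ) (ω : Ω) : ℝ≥0∞ :=
  ∑' n, ENNReal.ofReal (X n ω)

/-- The continuum cascade density. -/
def cascadeDensity (p x : ℝ) : ℝ :=
  (x - 1) ^ (2 * x - 1) * Real.exp (-(1 / p + 2 * Real.log p) * x + 1 / p) /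
    (x * Real.Gamma (2 * x))

/-! ### The approximating discrete branching processes -/

/-- The negative binomial mass function `b(n, r, q)`. -/
def negBinomial (n : ℕ) (r q : ℝ) : ℝ :=
  Real.Gamma (n + r) / (n ! * Real.Gamma r) * (1 - q) ^ r * q ^ n

/-- The parameter `r*` of the atomic offspring distribution with mesh `δ`. -/
def atomicR (p δ : ℝ) : ℝ := 2 * δ * p / (p - δ)

/-- The parameter `q*` of the atomic offspring distribution with mesh `δ`. -/
def atomicQ (p δ : ℝ) : ℝ := (p - δ) / p

/-- The `ξ i j` (the number of children of the `j`-th individual of generation `i`) are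
independent with the atomic distribution `NB(r*, q*)` of mesh `δ`. -/
structure IsAtomicOffspring {Ω : Type*} [MeasurableSpace Ω] (p δ : ℝ) (ξ : ℕ → ℕ → Ω → ℕ)
    (P : Measure Ω) : Prop where
  measurable : ∀ i j, Measurable (ξ i j)
  law : ∀ i j k, P {ω | ξ i j ω = k} =
    ENNReal.ofReal (negBinomial k (atomicR p δ) (atomicQ p δ))
  indep : iIndepFun (fun ij : ℕ × ℕ => ξ ij.1 ij.2) P

/-- Generation sizes of the discrete branching process started from `m` individuals. -/
def generationSize {Ω : Type*} (ξ : ℕ → ℕ → Ω → ℕ) (m : ℕ) : ℕ → Ω → ℕ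
  | 0, _ => m
  | i + 1, ω => ∑ j ∈ Finset.range (generationSize ξ m i ω), ξ i j ω

/-- The total number of individuals `Z_δ(m)` in all generations of the discrete branching process
started from `m` individuals, which may be infinite. -/
def totalProgeny {Ω : Type*} (ξ : ℕ → ℕ → Ω → ℕ) (m : ℕ) (ω : Ω) : ℝ≥0∞ :=
  ∑' i, (generationSize ξ m i ω : ℝ≥0∞)

/-- The mass that the total progeny `Z_δ(m)` gives to `n`. -/
def progenyMass (p δ : ℝ) (m n : ℕ) : ℝ :=
  (m : ℝ) / n *
    (Real.Gamma (n * (1 + atomicR p δ) - m) /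
      (Real.Gamma (n * atomicR p δ) * Real.Gamma (n - m + 1))) *
    (1 - atomicQ p δ) ^ (atomicR p δ * n) * atomicQ p δ ^ (n - m)

end GammaCascade

end

/-! The exact laws come from the hitting-time (Otter–Dwass) formula: the total progeny started from
`m` equals `n` with probability `m / n` times the probability that `n` individuals have `n - m`
children altogether. Both offspring families are closed under convolution, with shapes adding, so
that second probability is explicit: negative binomial of shape `n r` in the discrete case, Gamma of
shape `2 t` in the continuous one. These candidate laws satisfy the recursion obtained by splitting
off the first generation, for the same reason in both settings: the factor `k / N` (or `y / w`)
size-biases the first generation, size biasing raises its shape by one, and the convolution identity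
evaluates what remains (`borelMass_add`, `lintegral_gammaPDF_mul_progenyPDF`).

In the discrete model the recursion strictly lowers the total, so induction identifies the law. In
the continuous model there is no such induction. Instead, let `L a` be the Laplace transform at `s`
of the candidate density started from `a`. The recursion says that averaging `L` over the offspring
of `a` gives `exp (s a) * L a`, so `exp (-s (X 0 + ... + X (n - 1))) * L (X n)` has constant
expectation `L 1`. For large `s`, `L` is bounded on `a > 0` and tends to `1` as `a` decreases to
`0`. Where `Z` is finite, `X n` tends to `0` and the product tends to `exp (-s Z)`; where `Z` is
infinite it tends to `0`. Dominated convergence yields the Laplace transform of `Z` on `{Z < ∞}`,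
and uniqueness identifies the law. The total mass of `g` is never needed: its defect is the
probability that `Z` is infinite.

The continuum limit is a computation on the exact mass function: log-convexity of `Γ` controls `Γ (K
+ b) / Γ K`, and `(1 - 1 / (p m)) ^ m` produces the exponential. -/

noncomputable section

namespace GammaCascade

/-! ### Negative binomial coefficients -/

/-- The coefficient `a (a + 1) ⋯ (a + k - 1) / k!` of the negative binomial distribution. -/
def negBinCoeff (a : ℝ) (k : ℕ) : ℝ := (ascPochhammer ℝ k).eval a / k !

@[simp] lemma negBinCoeff_zero_right (a : ℝ) : negBinCoeff a 0 = 1 := by simp [negBinCoeff]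

lemma negBinCoeff_zero_left {k : ℕ} (hk : k ≠ 0) : negBinCoeff 0 k = 0 := by
  simp [negBinCoeff, hk]

/-- Size biasing: weighting by the value raises the shape by one and shifts the value down by one.
This drives both Vandermonde's identity and the progeny recursion. -/
lemma succ_mul_negBinCoeff_succ (a : ℝ) (k : ℕ) :
    ((k : ℝ) + 1) * negBinCoeff a (k + 1) = a * negBinCoeff (a + 1) k := by
  have h : ((k : ℝ) + 1) ≠ 0 := by positivity
  have h' : (k ! : ℝ) ≠ 0 := by positivity
  simp only [negBinCoeff, ascPochhammer_succ_left, Polynomial.eval_mul, Polynomial.eval_comp,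
    Polynomial.eval_X, Polynomial.eval_add, Polynomial.eval_one, Nat.factorial_succ]
  push_cast
  field_simp

lemma negBinCoeff_nonneg {a : ℝ} (ha : 0 ≤ a) (k : ℕ) : 0 ≤ negBinCoeff a k := by
  induction k generalizing a with
  | zero => simp
  | succ k ih =>
    have h1 := succ_mul_negBinCoeff_succ a k
    have h2 : 0 ≤ a * negBinCoeff (a + 1) k := mul_nonneg ha (ih (by linarith))
    rw [← h1] at h2
    exact nonneg_of_mul_nonneg_right h2 (by positivity)

lemma negBinCoeff_eq_Gamma {a : ℝ} (ha : 0 < a) (k : ℕ) :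
    negBinCoeff a k = Real.Gamma (k + a) / (k ! * Real.Gamma a) := by
  induction k generalizing a with
  | zero =>
    have := (Real.Gamma_pos_of_pos ha).ne'
    simp [this]
  | succ k ih =>
    have h1 := succ_mul_negBinCoeff_succ a k
    rw [ih (by linarith), Real.Gamma_add_one ha.ne'] at h1
    have h2 := (Real.Gamma_pos_of_pos ha).ne'
    have h : ((k : ℝ) + 1) ≠ 0 := by positivity
    have h' : (k ! : ℝ) ≠ 0 := by positivity
    rw [Nat.factorial_succ]
    push_cast
    rw [show (k : ℝ) + (a + 1) = k + 1 + a by ring] at h1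
    field_simp at h1 ⊢
    linarith

lemma sum_antidiagonal_mul_negBinCoeff_succ (f : ℕ → ℝ) (a : ℝ) (n : ℕ) :
    ∑ ij ∈ Finset.HasAntidiagonal.antidiagonal (n + 1), (ij.1 : ℝ) * negBinCoeff a ij.1 * f ij.2 =
      a * ∑ ij ∈ Finset.HasAntidiagonal.antidiagonal n, negBinCoeff (a + 1) ij.1 * f ij.2 := by
  rw [Finset.Nat.sum_antidiagonal_succ, Finset.mul_sum]
  simp [succ_mul_negBinCoeff_succ, mul_assoc]

/-- Vandermonde's identity for negative binomial coefficients. -/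
lemma sum_antidiagonal_negBinCoeff (a b : ℝ) (n : ℕ) :
    ∑ ij ∈ Finset.HasAntidiagonal.antidiagonal n, negBinCoeff a ij.1 * negBinCoeff b ij.2 =
      negBinCoeff (a + b) n := by
  induction n generalizing a b with
  | zero => simp
  | succ n ih =>
    have h : ((n : ℝ) + 1) ≠ 0 := by positivity
    -- On the antidiagonal `n + 1` is the sum of the two indices. Multiplying by it splits the sum
    -- into two size-biased ones, each reduced to the induction hypothesis at total shape `a + b +
    -- 1`.
    apply mul_left_cancel₀ h
    rw [succ_mul_negBinCoeff_succ]
    have h1 := sum_antidiagonal_mul_negBinCoeff_succ (negBinCoeff b) a n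
    have h2 := sum_antidiagonal_mul_negBinCoeff_succ (negBinCoeff a) b n
    rw [ih] at h1 h2
    rw [← Finset.Nat.sum_antidiagonal_swap] at h2
    rw [show a + b + 1 = a + 1 + b by ring, add_mul a b, ← h1]
    rw [show b + 1 + a = a + 1 + b by ring] at h2
    rw [← h2, ← Finset.sum_add_distrib, Finset.mul_sum]
    refine Finset.sum_congr rfl fun ij hij => ?_
    have : ((n : ℝ) + 1) = ij.1 + ij.2 := by exact_mod_cast (Finset.HasAntidiagonal.mem_antidiagonal.1 hij).symm
    rw [this]
    simp only [Prod.fst_swap, Prod.snd_swap]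
    ring

/-- The negative binomial mass function, extended to the shape `0`. -/
def negBinMass (q a : ℝ) (k : ℕ) : ℝ := negBinCoeff a k * (1 - q) ^ a * q ^ k

lemma negBinMass_nonneg {q a : ℝ} (hq : 0 ≤ q) (hq1 : q ≤ 1) (ha : 0 ≤ a) (k : ℕ) :
    0 ≤ negBinMass q a k := by
  have := negBinCoeff_nonneg ha k
  have : 0 ≤ 1 - q := by linarith
  unfold negBinMass
  positivity

lemma negBinomial_eq_negBinMass {r : ℝ} (hr : 0 < r) (q : ℝ) (k : ℕ) :
    negBinomial k r q = negBinMass q r k := by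
  rw [negBinomial, negBinMass, negBinCoeff_eq_Gamma hr]

lemma sum_antidiagonal_negBinMass {q : ℝ} (hq1 : q < 1) (a b : ℝ) (n : ℕ) :
    ∑ ij ∈ Finset.HasAntidiagonal.antidiagonal n, negBinMass q a ij.1 * negBinMass q b ij.2 =
      negBinMass q (a + b) n := by
  rw [negBinMass, ← sum_antidiagonal_negBinCoeff, Finset.sum_mul, Finset.sum_mul]
  refine Finset.sum_congr rfl fun ij hij => ?_
  rw [← Finset.HasAntidiagonal.mem_antidiagonal.1 hij, Real.rpow_add (by linarith), pow_add]
  simp only [negBinMass]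
  ring

/-! ### The mass function of the total progeny -/

/-- The total progeny mass function `(m / n) b(n - m, n r, q)`. -/
def borelMass (r q : ℝ) (m n : ℕ) : ℝ := (m : ℝ) / n * negBinMass q (n * r) (n - m)

lemma borelMass_nonneg {r q : ℝ} (hr : 0 ≤ r) (hq : 0 ≤ q) (hq1 : q ≤ 1) (m n : ℕ) :
    0 ≤ borelMass r q m n :=
  mul_nonneg (by positivity) (negBinMass_nonneg hq hq1 (by positivity) _)

lemma progenyMass_eq_borelMass {p δ : ℝ} (hr : 0 < atomicR p δ) {m n : ℕ} (hn : 1 ≤ n)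
    (hmn : m ≤ n) :
    progenyMass p δ m n = borelMass (atomicR p δ) (atomicQ p δ) m n := by
  have hn' : (0 : ℝ) < n := by exact_mod_cast hn
  rw [progenyMass, borelMass, negBinMass, negBinCoeff_eq_Gamma (by positivity),
    ← Real.Gamma_nat_eq_factorial, Nat.cast_sub hmn, mul_comm (atomicR p δ) n,
    show (n : ℝ) * (1 + atomicR p δ) - m = n - m + n * atomicR p δ by ring,
    mul_comm (Real.Gamma ((n : ℝ) * atomicR p δ))]
  ring

/-- The total progeny law decomposes according to the size of the first generation. -/
lemma borelMass_add {r q : ℝ} (hr : 0 < r) (hq1 : q < 1) {m : ℕ} (hm : 1 ≤ m) {N : ℕ}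
    (hN : 1 ≤ N) :
    borelMass r q m (m + N) =
      ∑ k ∈ Finset.range (N + 1), negBinMass q (m * r) k * borelMass r q k N := by
  obtain ⟨N, rfl⟩ : ∃ M, N = M + 1 := ⟨N - 1, by omega⟩
  have hm' : (0 : ℝ) < m := by exact_mod_cast hm
  rw [← Finset.Nat.sum_antidiagonal_eq_sum_range_succ_mk
    (f := fun ij => negBinMass q (m * r) ij.1 * borelMass r q ij.1 (N + 1))]
  have h1 := sum_antidiagonal_mul_negBinCoeff_succ (negBinCoeff ((N + 1 : ℕ) * r)) (m * r) N
  rw [sum_antidiagonal_negBinCoeff] at h1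
  have h2 := succ_mul_negBinCoeff_succ (((m + (N + 1) : ℕ) : ℝ) * r) N
  -- The factor `ij.1 / (N + 1)` is the size bias, and the powers of `q` and `1 - q` combine to a
  -- constant along the antidiagonal. Vandermonde with shapes `m * r + 1` and `(N + 1) * r` then
  -- gives the sum.
  have key : ∀ ij ∈ Finset.HasAntidiagonal.antidiagonal (N + 1),
      negBinMass q (m * r) ij.1 * borelMass r q ij.1 (N + 1) =
        ((ij.1 : ℝ) * negBinCoeff (m * r) ij.1 * negBinCoeff ((N + 1 : ℕ) * r) ij.2) *
          ((1 - q) ^ (((m + (N + 1) : ℕ) : ℝ) * r) * q ^ (N + 1) / (N + 1 : ℕ)) := by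
    intro ij hij
    have h := Finset.HasAntidiagonal.mem_antidiagonal.1 hij
    have h3 : N + 1 - ij.1 = ij.2 := by omega
    have h4 : q ^ (N + 1) = q ^ ij.1 * q ^ ij.2 := by rw [← h, pow_add]
    rw [borelMass, negBinMass, negBinMass, h3, Nat.cast_add m, add_mul (m : ℝ),
      Real.rpow_add (by linarith), h4]
    ring
  rw [Finset.sum_congr rfl key, ← Finset.sum_mul, h1, borelMass, negBinMass,
    Nat.add_sub_cancel_left]
  have e : ((m : ℝ) * r + 1 + (N + 1 : ℕ) * r) = ((m + (N + 1) : ℕ) : ℝ) * r + 1 := by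
    push_cast; ring
  rw [e]
  generalize negBinCoeff (((m + (N + 1) : ℕ) : ℝ) * r + 1) N = A at *
  generalize negBinCoeff (((m + (N + 1) : ℕ) : ℝ) * r) (N + 1) = B at *
  have hN1 : (0 : ℝ) < (N : ℝ) + 1 := by positivity
  have hB : B = ((m + (N + 1) : ℕ) : ℝ) * r * A / (N + 1) := by
    field_simp; linarith
  rw [hB]
  push_cast
  field_simp

/-! ### The discrete branching process -/

section Discrete

variable {Ω : Type*}

/-- The definition peels off the last generation; the recursion for the total progeny needs the
first one peeled off, with the remaining rows as a fresh offspring array. -/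
lemma generationSize_succ' (ξ : ℕ → ℕ → Ω → ℕ) (m i : ℕ) (ω : Ω) :
    generationSize ξ m (i + 1) ω =
      generationSize (fun i => ξ (i + 1)) (∑ j ∈ Finset.range m, ξ 0 j ω) i ω := by
  induction i with
  | zero => rfl
  | succ i ih => rw [generationSize, ih]; rfl

lemma totalProgeny_eq_add (ξ : ℕ → ℕ → Ω → ℕ) (m : ℕ) (ω : Ω) :
    totalProgeny ξ m ω =
      m + totalProgeny (fun i => ξ (i + 1)) (∑ j ∈ Finset.range m, ξ 0 j ω) ω := by
  rw [totalProgeny, tsum_eq_zero_add' ENNReal.summable]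
  simp only [generationSize_succ']
  rfl

lemma le_totalProgeny (ξ : ℕ → ℕ → Ω → ℕ) (m : ℕ) (ω : Ω) : (m : ℝ≥0∞) ≤ totalProgeny ξ m ω := by
  rw [totalProgeny_eq_add]; exact le_self_add

lemma totalProgeny_zero (ξ : ℕ → ℕ → Ω → ℕ) (ω : Ω) : totalProgeny ξ 0 ω = 0 := by
  have h : ∀ i, generationSize ξ 0 i ω = 0 := by
    intro i
    induction i with
    | zero => rfl
    | succ i ih => simp [generationSize, ih]
  simp [totalProgeny, h]

lemma totalProgeny_eq_zero_iff (ξ : ℕ → ℕ → Ω → ℕ) (m : ℕ) (ω : Ω) :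
    totalProgeny ξ m ω = 0 ↔ m = 0 := by
  refine ⟨fun h => ?_, fun h => h ▸ totalProgeny_zero ξ ω⟩
  simpa [h] using le_totalProgeny ξ m ω

lemma measurable_generationSize [MeasurableSpace Ω] {ξ : ℕ → ℕ → Ω → ℕ}
    (h : ∀ i j, Measurable (ξ i j)) (m i : ℕ) : Measurable (generationSize ξ m i) := by
  induction i with
  | zero => exact measurable_const
  | succ i ih =>
    have h1 : Measurable (fun z : ℕ × Ω => ∑ j ∈ Finset.range z.1, ξ i j z.2) :=
      measurable_from_prod_countable_right fun k => by
        exact Finset.measurable_sum (Finset.range k) fun j _ => h i j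
    exact h1.comp (ih.prodMk measurable_id)

/-- The σ-algebra on `Ω` is arbitrary, so that the lemma also applies to the one generated by the
later rows alone, as independence from the first generation requires. -/
lemma measurable_totalProgeny [MeasurableSpace Ω] {ξ : ℕ → ℕ → Ω → ℕ}
    (h : ∀ i j, Measurable (ξ i j)) (m : ℕ) : Measurable (totalProgeny ξ m) :=
  Measurable.tsum fun i =>
    (measurable_of_countable (fun n : ℕ => (n : ℝ≥0∞))).comp (measurable_generationSize h m i)

variable [MeasurableSpace Ω] {p δ : ℝ} {ξ : ℕ → ℕ → Ω → ℕ} {P : Measure Ω}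

lemma IsAtomicOffspring.shift (h : IsAtomicOffspring p δ ξ P) :
    IsAtomicOffspring p δ (fun i => ξ (i + 1)) P where
  measurable i j := h.measurable _ _
  law i j k := h.law _ _ _
  indep := h.indep.precomp (g := fun ij : ℕ × ℕ => (ij.1 + 1, ij.2)) (by
    rintro ⟨a, b⟩ ⟨c, d⟩ hab
    simpa using hab)

/-- Events of the first generation are independent of those of the later ones. -/
lemma IsAtomicOffspring.measure_inter (h : IsAtomicOffspring p δ ξ P) (m k l : ℕ) (n : ℝ≥0∞) :
    P ({ω | ∑ j ∈ Finset.range m, ξ 0 j ω = k} ∩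
        {ω | totalProgeny (fun i => ξ (i + 1)) l ω = n}) =
      P {ω | ∑ j ∈ Finset.range m, ξ 0 j ω = k} *
        P {ω | totalProgeny (fun i => ξ (i + 1)) l ω = n} := by
  let M : ℕ × ℕ → MeasurableSpace Ω := fun ij => MeasurableSpace.comap (ξ ij.1 ij.2) ⊤
  let S : Set (ℕ × ℕ) := {ij | ij.1 = 0}
  let T : Set (ℕ × ℕ) := {ij | ij.1 ≠ 0}
  have hST : Disjoint S T := Set.disjoint_left.2 fun ij h1 h2 => h2 h1
  have hM : ∀ ij, M ij ≤ ‹MeasurableSpace Ω› := fun ij => (h.measurable ij.1 ij.2).comap_le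
  have hind : Indep (⨆ ij ∈ S, M ij) (⨆ ij ∈ T, M ij) P :=
    indep_iSup_of_disjoint hM h.indep hST
  have key : ∀ (U : Set (ℕ × ℕ)) (i j : ℕ), (i, j) ∈ U →
      Measurable[⨆ ij ∈ U, M ij] (ξ i j) := fun U i j hU =>
    Measurable.mono (comap_measurable (ξ i j)) (le_iSup₂_of_le (i, j) hU le_rfl) le_rfl
  refine (Indep_iff _ _ _).1 hind _ _ ?_ ?_
  · have : Measurable[⨆ ij ∈ S, M ij] (fun ω => ∑ j ∈ Finset.range m, ξ 0 j ω) :=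
      @Finset.measurable_sum _ _ _ _ _ _ (_) _ _ fun j _ => key S 0 j rfl
    exact this (measurableSet_singleton k)
  · have : Measurable[⨆ ij ∈ T, M ij] (totalProgeny (fun i => ξ (i + 1)) l) :=
      @measurable_totalProgeny _ (_) _ (fun i j => key T (i + 1) j (Nat.succ_ne_zero i)) l
    exact this (measurableSet_singleton n)

/-- The size of the first generation is negative binomial. -/
lemma IsAtomicOffspring.measure_sum_eq [IsProbabilityMeasure P] (h : IsAtomicOffspring p δ ξ P)
    (hr : 0 < atomicR p δ) (hq : 0 ≤ atomicQ p δ) (hq1 : atomicQ p δ < 1) (m k : ℕ) :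
    P {ω | ∑ j ∈ Finset.range m, ξ 0 j ω = k} =
      ENNReal.ofReal (negBinMass (atomicQ p δ) (m * atomicR p δ) k) := by
  have hpos : ∀ m : ℕ, 0 ≤ (m : ℝ) * atomicR p δ := fun m => by positivity
  induction m generalizing k with
  | zero =>
    by_cases hk : k = 0
    · simp [hk, negBinMass]
    · simp [Ne.symm hk, negBinMass, negBinCoeff_zero_left hk]
  | succ m ih =>
    have hind : IndepFun (∑ j ∈ Finset.range m, ξ 0 j) (ξ 0 m) P :=
      (h.indep.precomp (g := fun j : ℕ => (0, j)) (fun a b hab => by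
        simpa using hab)).indepFun_sum_range_succ (fun j => h.measurable 0 j) m
    have hset : {ω | ∑ j ∈ Finset.range (m + 1), ξ 0 j ω = k} =
        ⋃ ij ∈ Finset.HasAntidiagonal.antidiagonal k,
          ((∑ j ∈ Finset.range m, ξ 0 j) ⁻¹' {ij.1} ∩ ξ 0 m ⁻¹' {ij.2}) := by
      ext ω
      simp only [mem_ofPred_eq, Finset.sum_range_succ, mem_iUnion, mem_inter_iff, mem_preimage,
        Finset.sum_apply, mem_singleton_iff, Finset.HasAntidiagonal.mem_antidiagonal, exists_prop,
        Prod.exists]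
      constructor
      · intro h; exact ⟨_, _, h, rfl, rfl⟩
      · rintro ⟨a, b, h, rfl, rfl⟩; exact h
    have hmeas : Measurable (∑ j ∈ Finset.range m, ξ 0 j) := by
      have := Finset.measurable_sum (Finset.range m) fun j _ => h.measurable 0 j
      simpa only [← Finset.sum_apply] using! this
    rw [hset, measure_biUnion_finset]
    · rw [Nat.cast_succ, add_mul, one_mul, ← sum_antidiagonal_negBinMass hq1,
        ENNReal.ofReal_sum_of_nonneg]
      · refine Finset.sum_congr rfl fun ij _ => ?_
        rw [hind.measure_inter_preimage_eq_mul _ _ (measurableSet_singleton _)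
          (measurableSet_singleton _), ENNReal.ofReal_mul (negBinMass_nonneg hq hq1.le (hpos m) _),
          ← ih, ← negBinomial_eq_negBinMass hr, ← h.law 0 m]
        congr 2
        ext ω
        simp
      · exact fun ij _ => mul_nonneg (negBinMass_nonneg hq hq1.le (hpos m) _)
          (negBinMass_nonneg hq hq1.le hr.le _)
    · intro a _ b _ hab
      refine Set.disjoint_left.2 fun ω h1 h2 => hab ?_
      simp only [mem_inter_iff, mem_preimage, mem_singleton_iff] at h1 h2
      exact Prod.ext (h1.1.symm.trans h2.1) (h1.2.symm.trans h2.2)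
    · exact fun ij _ => (hmeas (measurableSet_singleton _)).inter
        (h.measurable 0 m (measurableSet_singleton _))

/-- The exact law of the total progeny of the discrete branching process. -/
theorem IsAtomicOffspring.measure_totalProgeny_eq [IsProbabilityMeasure P]
    (h : IsAtomicOffspring p δ ξ P) (hr : 0 < atomicR p δ) (hq : 0 ≤ atomicQ p δ)
    (hq1 : atomicQ p δ < 1) {m n : ℕ} (hn : 1 ≤ n) (hmn : m ≤ n) :
    P {ω | totalProgeny ξ m ω = n} =
      ENNReal.ofReal (borelMass (atomicR p δ) (atomicQ p δ) m n) := by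
  -- The array varies in the induction because the recursion passes to its shift, and the initial
  -- size because it becomes the size of the first generation.
  induction n using Nat.strong_induction_on generalizing ξ m with
  | _ n ih =>
  obtain rfl | hm := Nat.eq_zero_or_pos m
  · have h0 : ¬ (0 : ℝ≥0∞) = n := by exact_mod_cast (by omega : ¬ 0 = n)
    simp [totalProgeny_zero, h0, borelMass]
  obtain ⟨N, rfl⟩ := Nat.exists_eq_add_of_le hmn
  have hZ : ∀ ω, (totalProgeny ξ m ω = (m + N : ℕ) ↔
      totalProgeny (fun i => ξ (i + 1)) (∑ j ∈ Finset.range m, ξ 0 j ω) ω = N) := by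
    intro ω
    rw [totalProgeny_eq_add, Nat.cast_add, ENNReal.add_right_inj (ENNReal.natCast_ne_top m)]
  simp only [hZ]
  -- A total equal to the initial size means an empty first generation. This case stands apart
  -- because the recursion divides by `N`.
  obtain rfl | hN := Nat.eq_zero_or_pos N
  · simp only [Nat.cast_zero, totalProgeny_eq_zero_iff]
    rw [h.measure_sum_eq hr hq hq1]
    have : (m : ℝ) ≠ 0 := by exact_mod_cast hm.ne'
    simp [borelMass, this]
  -- The first generation is itself counted in the later total, so its size is at most `N` and the
  -- decomposition is finite.
  have hset : {ω | totalProgeny (fun i => ξ (i + 1)) (∑ j ∈ Finset.range m, ξ 0 j ω) ω = N} =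
      ⋃ k ∈ Finset.range (N + 1), ({ω | ∑ j ∈ Finset.range m, ξ 0 j ω = k} ∩
        {ω | totalProgeny (fun i => ξ (i + 1)) k ω = N}) := by
    ext ω
    simp only [mem_ofPred_eq, mem_iUnion, mem_inter_iff, Finset.mem_range, exists_prop]
    constructor
    · intro hω
      refine ⟨_, ?_, rfl, hω⟩
      have := le_totalProgeny (fun i => ξ (i + 1)) (∑ j ∈ Finset.range m, ξ 0 j ω) ω
      rw [hω] at this
      exact Nat.lt_succ_of_le (by exact_mod_cast this)
    · rintro ⟨k, _, rfl, hω⟩; exact hω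
  rw [hset, measure_biUnion_finset]
  · rw [borelMass_add hr hq1 hm hN, ENNReal.ofReal_sum_of_nonneg]
    · refine Finset.sum_congr rfl fun k hk => ?_
      rw [h.measure_inter, h.measure_sum_eq hr hq hq1,
        ih N (by omega) h.shift hN (by simpa [Nat.lt_succ_iff] using hk),
        ENNReal.ofReal_mul (negBinMass_nonneg hq hq1.le (by positivity) _)]
    · exact fun k _ => mul_nonneg (negBinMass_nonneg hq hq1.le (by positivity) _)
        (borelMass_nonneg hr.le hq hq1.le _ _)
  · intro a _ b _ hab
    refine Set.disjoint_left.2 fun ω h1 h2 => hab ?_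
    exact h1.1.symm.trans h2.1
  · exact fun k _ => ((Finset.measurable_sum _ fun j _ => h.measurable 0 j)
      (measurableSet_singleton k)).inter
      (measurable_totalProgeny (fun i j => h.measurable _ _) k (measurableSet_singleton _))

end Discrete

lemma atomicR_pos {p δ : ℝ} (hδ : 0 < δ) (hδp : δ < p) : 0 < atomicR p δ := by
  have : 0 < p - δ := by linarith
  have : 0 < p := by linarith
  unfold atomicR
  positivity

lemma atomicQ_nonneg {p δ : ℝ} (hδ : 0 < δ) (hδp : δ < p) : 0 ≤ atomicQ p δ :=
  div_nonneg (by linarith) (by linarith)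

lemma atomicQ_lt_one {p δ : ℝ} (hδ : 0 < δ) (hδp : δ < p) : atomicQ p δ < 1 := by
  rw [atomicQ, div_lt_one (by linarith)]
  linarith

/-! ### The continuum limit -/

/-- By convexity of `log Γ`, its slope on `[K, K + b]` is at least its slope on `[K - 1, K]`, which
is `log (K - 1)`. -/
lemma rpow_mul_Gamma_le_Gamma_add {K b : ℝ} (hK : 1 < K) (hb : 0 < b) :
    (K - 1) ^ b * Real.Gamma K ≤ Real.Gamma (K + b) := by
  have hK0 : 0 < K := by linarith
  have h := Real.convexOn_log_Gamma.slope_mono_adjacent (x := K - 1) (y := K) (z := K + b)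
    (by simpa using hK) (by simp only [mem_Ioi]; linarith) (by linarith) (by linarith)
  have hG : Real.Gamma K = (K - 1) * Real.Gamma (K - 1) := by
    have := Real.Gamma_add_one (s := K - 1) (by linarith)
    simpa using this
  have hG1 := Real.Gamma_pos_of_pos (show 0 < K - 1 by linarith)
  have hG2 := Real.Gamma_pos_of_pos hK0
  have hG3 := Real.Gamma_pos_of_pos (show 0 < K + b by linarith)
  simp only [Function.comp_apply] at h
  rw [show K + b - K = b by ring, show K - (K - 1) = 1 by ring, div_one, le_div_iff₀ hb] at h
  rw [show Real.log (Real.Gamma K) - Real.log (Real.Gamma (K - 1)) = Real.log (K - 1) by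
    rw [hG, Real.log_mul (by linarith) hG1.ne']; ring] at h
  rw [Real.rpow_def_of_pos (by linarith), ← Real.exp_log hG2, ← Real.exp_log hG3, ← Real.exp_add,
    Real.exp_le_exp]
  linarith

/-- Same argument with the unit interval on the right: the slope of `log Γ` on `[K + b, K + b + 1]`
is `log (K + b)`. -/
lemma Gamma_add_le_rpow_mul_Gamma {K b : ℝ} (hK : 0 < K) (hb : 0 < b) :
    Real.Gamma (K + b) ≤ (K + b) ^ b * Real.Gamma K := by
  have h := Real.convexOn_log_Gamma.slope_mono_adjacent (x := K) (y := K + b) (z := K + b + 1)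
    hK (by simp only [mem_Ioi]; linarith) (by linarith) (by linarith)
  have hG := Real.Gamma_add_one (s := K + b) (by linarith)
  have hG2 := Real.Gamma_pos_of_pos hK
  have hG3 := Real.Gamma_pos_of_pos (show 0 < K + b by linarith)
  simp only [Function.comp_apply] at h
  rw [show K + b - K = b by ring, show K + b + 1 - (K + b) = 1 by ring, div_one,
    div_le_iff₀ hb, hG, Real.log_mul (by linarith) hG3.ne'] at h
  rw [Real.rpow_def_of_pos (by linarith), ← Real.exp_log hG2, ← Real.exp_log hG3, ← Real.exp_add,
    Real.exp_le_exp]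
  linarith

lemma negBinCoeff_eq_Gamma_div {a : ℝ} (ha : 0 < a) {k : ℕ} (hk : 0 < k) :
    negBinCoeff a k = Real.Gamma (k + a) / Real.Gamma k / (k * Real.Gamma a) := by
  have hk' : (0 : ℝ) < k := by exact_mod_cast hk
  rw [negBinCoeff_eq_Gamma ha, ← Real.Gamma_nat_eq_factorial, Real.Gamma_add_one hk'.ne']
  have := (Real.Gamma_pos_of_pos hk').ne'
  have := (Real.Gamma_pos_of_pos ha).ne'
  field_simp

lemma cascadeDensity_eq {p x : ℝ} (hp : 0 < p) (hx : 1 < x) :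
    cascadeDensity p x = ((x - 1) / p) ^ (2 * x) / (x * (x - 1) * Real.Gamma (2 * x)) *
      Real.exp (-(x - 1) / p) := by
  have h : 0 < x - 1 := by linarith
  have hG := (Real.Gamma_pos_of_pos (show 0 < 2 * x by linarith)).ne'
  have e : Real.exp (-(1 / p + 2 * Real.log p) * x + 1 / p) =
      Real.exp (-(x - 1) / p) / p ^ (2 * x) := by
    rw [Real.rpow_def_of_pos hp, ← Real.exp_sub]
    congr 1
    field_simp
    ring
  have hp' := (Real.rpow_pos_of_pos hp (2 * x)).ne'
  rw [cascadeDensity, e, Real.rpow_sub_one h.ne', Real.div_rpow h.le hp.le]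
  field_simp

/-- The rescaled discrete total progeny laws converge to the cascade density. -/
theorem tendsto_borelMass {p x : ℝ} (hp : 0 < p) (hx : 1 < x) :
    Tendsto (fun m : ℕ => (m : ℝ) *
      borelMass (atomicR p (1 / m)) (atomicQ p (1 / m)) m ⌊m * x⌋₊) atTop
      (𝓝 (cascadeDensity p x)) := by
  have hx1 : 0 < x - 1 := by linarith
  let n : ℕ → ℕ := fun m => ⌊(m : ℝ) * x⌋₊
  -- `K` is the number of non-initial individuals and `b` the shape of their law; `K / m` tends to
  -- `x - 1` and `b` to `2 x`.
  let K : ℕ → ℕ := fun m => n m - m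
  let b : ℕ → ℝ := fun m => n m * atomicR p (1 / m)
  have hcast := tendsto_natCast_atTop_atTop (R := ℝ)
  have hinv : Tendsto (fun m : ℕ => (1 : ℝ) / m) atTop (𝓝 0) := tendsto_one_div_atTop_nhds_zero_nat
  have hm0 : ∀ᶠ m : ℕ in atTop, (0 : ℝ) < m :=
    (eventually_gt_atTop 0).mono fun m hm => by exact_mod_cast hm
  have hmp : ∀ᶠ m : ℕ in atTop, 1 / (m : ℝ) < p := hinv.eventually_lt_const hp
  have hn : Tendsto (fun m => (n m : ℝ) / m) atTop (𝓝 x) := by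
    have := (tendsto_nat_floor_mul_div_atTop (R := ℝ) (a := x) (by linarith)).comp hcast
    exact this.congr fun m => by simp [n, mul_comm]
  have hmn : ∀ m, m ≤ n m := fun m => Nat.le_floor (by
    have : (0 : ℝ) ≤ m := by positivity
    nlinarith)
  have hKn : ∀ m, (K m : ℝ) = n m - m := fun m => by
    simp only [K]; rw [Nat.cast_sub (hmn m)]
  have hK : Tendsto (fun m => (K m : ℝ) / m) atTop (𝓝 (x - 1)) := by
    refine (hn.sub_const 1).congr' ?_
    filter_upwards [hm0] with m hm
    rw [hKn]; field_simp
  have hKtop : Tendsto (fun m => (K m : ℝ)) atTop atTop := by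
    refine (hK.pos_mul_atTop hx1 hcast).congr' ?_
    filter_upwards [hm0] with m hm
    field_simp
  have hb : Tendsto b atTop (𝓝 (2 * x)) := by
    have h1 : Tendsto (fun m : ℕ => (n m : ℝ) / m * (2 * p / (p - 1 / m))) atTop
        (𝓝 (x * (2 * p / (p - 0)))) :=
      hn.mul (Tendsto.div tendsto_const_nhds (hinv.const_sub p) (by simpa using hp.ne'))
    rw [show x * (2 * p / (p - 0)) = 2 * x by rw [sub_zero]; field_simp] at h1
    refine h1.congr' ?_
    filter_upwards [hm0, hmp] with m hm hmp
    have : p - 1 / m ≠ 0 := by linarith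
    simp only [b, atomicR]
    field_simp
  have hG : Tendsto (fun m => Real.Gamma (b m)) atTop (𝓝 (Real.Gamma (2 * x))) := by
    refine (Real.differentiableAt_Gamma fun k => ?_).continuousAt.tendsto.comp hb
    have : (0 : ℝ) ≤ k := by positivity
    linarith
  -- Since `q = 1 - 1 / (p m)`, the power is `(q ^ m) ^ (K / m)`.
  have hq : Tendsto (fun m : ℕ => atomicQ p (1 / m) ^ K m) atTop
      (𝓝 (Real.exp (-(x - 1) / p))) := by
    have h1 := (Real.tendsto_one_add_div_pow_exp (-(1 / p))).rpow hK (Or.inl (Real.exp_pos _).ne')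
    rw [← Real.exp_mul, show -(1 / p) * (x - 1) = -(x - 1) / p by ring] at h1
    refine h1.congr' ?_
    filter_upwards [hm0, hmp] with m hm hmp
    have e : 1 + -(1 / p) / m = atomicQ p (1 / m) := by
      rw [atomicQ]; field_simp; ring
    have h0 : 0 ≤ atomicQ p (1 / m) := atomicQ_nonneg (by positivity) hmp
    rw [e, ← Real.rpow_natCast, ← Real.rpow_mul h0, ← Real.rpow_natCast]
    congr 1
    field_simp
  have hlow : Tendsto (fun m : ℕ => (((K m : ℝ) - 1) / (m * p)) ^ b m) atTop
      (𝓝 (((x - 1) / p) ^ (2 * x))) := by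
    refine Tendsto.rpow ?_ hb (Or.inl (by positivity))
    have := (hK.sub hinv).div_const p
    rw [sub_zero] at this
    refine this.congr' ?_
    filter_upwards [hm0] with m hm
    field_simp
  have hupp : Tendsto (fun m : ℕ => (((K m : ℝ) + b m) / (m * p)) ^ b m) atTop
      (𝓝 (((x - 1) / p) ^ (2 * x))) := by
    refine Tendsto.rpow ?_ hb (Or.inl (by positivity))
    have := (hK.add (hb.mul hinv)).div_const p
    rw [mul_zero, add_zero] at this
    refine this.congr' ?_
    filter_upwards [hm0] with m hm
    field_simp
  have hbpos : ∀ᶠ m in atTop, 0 < b m := hb.eventually_const_lt (by linarith)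
  -- Here `1 / (m p)` is `1 - q`. The Gamma ratio is squeezed between `(K - 1) ^ b` and `(K + b) ^
  -- b`, which agree in the limit after scaling by `m p`.
  have hmain : Tendsto (fun m : ℕ =>
      Real.Gamma (K m + b m) / Real.Gamma (K m) * (1 / (m * p)) ^ b m) atTop
      (𝓝 (((x - 1) / p) ^ (2 * x))) := by
    refine tendsto_of_tendsto_of_tendsto_of_le_of_le' hlow hupp ?_ ?_
    · filter_upwards [hm0, hbpos, hKtop.eventually_gt_atTop 1] with m hm hb hK
      rw [div_eq_mul_one_div, Real.mul_rpow (by linarith) (by positivity)]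
      gcongr
      rw [le_div_iff₀ (Real.Gamma_pos_of_pos (by linarith))]
      exact rpow_mul_Gamma_le_Gamma_add hK hb
    · filter_upwards [hm0, hbpos, hKtop.eventually_gt_atTop 1] with m hm hb hK
      rw [div_eq_mul_one_div ((K m : ℝ) + b m), Real.mul_rpow (by linarith) (by positivity)]
      gcongr
      rw [div_le_iff₀ (Real.Gamma_pos_of_pos (by linarith))]
      exact Gamma_add_le_rpow_mul_Gamma (by linarith) hb
  have hfin := (hmain.div ((hn.mul hK).mul hG) (by
    have := (Real.Gamma_pos_of_pos (show 0 < 2 * x by linarith)).ne'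
    have : x ≠ 0 := by linarith
    positivity)).mul hq
  rw [← cascadeDensity_eq hp hx] at hfin
  refine hfin.congr' ?_
  filter_upwards [hm0, hbpos, hKtop.eventually_gt_atTop 1] with m hm hb hK
  have h1 : 1 - atomicQ p (1 / m) = 1 / (m * p) := by
    rw [atomicQ]; field_simp; ring
  have hn0 : (0 : ℝ) < n m := lt_of_lt_of_le hm (by exact_mod_cast hmn m)
  have hK0 : (0 : ℝ) < K m := by linarith
  have hGb := (Real.Gamma_pos_of_pos hb).ne'
  have hGK := (Real.Gamma_pos_of_pos hK0).ne'
  change _ = (m : ℝ) * ((m : ℝ) / n m * negBinMass (atomicQ p (1 / m)) (b m) (K m))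
  simp only [Pi.div_apply]
  rw [negBinMass, negBinCoeff_eq_Gamma_div hb (by exact_mod_cast hK0), h1]
  field_simp

/-! ### Convolution of Gamma densities -/

lemma ae_ne_real (a : ℝ) : ∀ᵐ x : ℝ, x ≠ a := by
  simp [ae_iff]

lemma lintegral_eq_setLIntegral_of_ae {s : Set ℝ} (hs : MeasurableSet s) {f : ℝ → ℝ≥0∞}
    (h : ∀ᵐ x : ℝ, x ∉ s → f x = 0) : ∫⁻ x, f x = ∫⁻ x in s, f x := by
  rw [← lintegral_indicator hs]
  refine lintegral_congr_ae (h.mono fun x hx => ?_)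
  by_cases hxs : x ∈ s <;> simp [hxs, hx]

/-- Convolution of Gamma densities of the same rate adds the shapes. -/
lemma lintegral_gammaPDF_mul_gammaPDF {α β r w : ℝ} (hα : 0 < α) (hβ : 0 < β) (hr : 0 < r)
    (hw : 0 < w) :
    ∫⁻ y, gammaPDF α r y * gammaPDF β r (w - y) = gammaPDF (α + β) r w := by
  rw [lintegral_eq_setLIntegral_of_ae (s := Ioo 0 w) measurableSet_Ioo]
  · have himg : (fun u => w * u) '' Ioo 0 1 = Ioo 0 w := by
      rw [image_mul_left_Ioo hw]; simp
    rw [← himg, lintegral_image_eq_lintegral_abs_deriv_mul (f' := fun _ => w) measurableSet_Ioo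
      (fun x _ => by simpa using ((hasDerivAt_id x).const_mul w).hasDerivWithinAt)
      (fun a _ b _ h => mul_left_cancel₀ hw.ne' h)]
    have hB := lintegral_betaPDF_eq_one hα hβ
    rw [lintegral_betaPDF] at hB
    rw [← mul_one (gammaPDF (α + β) r w), ← hB, ← lintegral_const_mul _ (by fun_prop)]
    refine setLIntegral_congr_fun measurableSet_Ioo fun u hu => ?_
    have h1 : 0 < 1 - u := by linarith [hu.2]
    have h0 := hu.1
    have hwu : 0 ≤ w * u := by positivity
    have hwu' : 0 ≤ w - w * u := by nlinarith
    have hG := Real.Gamma_pos_of_pos hα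
    have hG' := Real.Gamma_pos_of_pos hβ
    have hG'' := Real.Gamma_pos_of_pos (add_pos hα hβ)
    rw [gammaPDF_of_nonneg hwu, gammaPDF_of_nonneg hwu', gammaPDF_of_nonneg hw.le,
      ← ENNReal.ofReal_mul (by positivity), ← ENNReal.ofReal_mul (by positivity),
      ← ENNReal.ofReal_mul (by positivity)]
    congr 1
    rw [abs_of_pos hw, beta, show w - w * u = w * (1 - u) by ring,
      Real.mul_rpow hw.le h0.le, Real.mul_rpow hw.le h1.le, Real.rpow_add hr,
      Real.rpow_sub_one hw.ne', Real.rpow_sub_one hw.ne', Real.rpow_sub_one hw.ne',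
      Real.rpow_add hw,
      show -(r * w) = -(r * (w * u)) + -(r * (w * (1 - u))) by ring, Real.exp_add]
    field_simp
  · filter_upwards [ae_ne_real 0, ae_ne_real w] with y h0 h1 hy
    rcases lt_or_gt_of_ne h0 with h | h
    · simp [gammaPDF_of_neg h]
    · have : w < y := lt_of_le_of_ne (not_lt.1 fun h' => hy ⟨h, h'⟩) h1.symm
      simp [gammaPDF_of_neg (sub_neg.2 this)]

/-- Size biasing a Gamma density raises its shape by one. -/
lemma ofReal_mul_gammaPDF {c r : ℝ} (hc : 0 < c) (hr : 0 < r) {y : ℝ} (hy : y ≠ 0) :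
    ENNReal.ofReal y * gammaPDF c r y = ENNReal.ofReal (c / r) * gammaPDF (c + 1) r y := by
  rcases lt_or_gt_of_ne hy with h | h
  · simp [gammaPDF_of_neg h]
  · have hG := (Real.Gamma_pos_of_pos hc).ne'
    rw [gammaPDF_of_nonneg h.le, gammaPDF_of_nonneg h.le, ← ENNReal.ofReal_mul h.le,
      ← ENNReal.ofReal_mul (by positivity)]
    congr 1
    rw [Real.Gamma_add_one hc.ne', Real.rpow_add hr, Real.rpow_one, add_sub_cancel_right,
      Real.rpow_sub_one hy]
    field_simp

/-! ### The total progeny density -/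

/-- The density at `t` of the total progeny started from `a`. -/
def progenyPDF (r a t : ℝ) : ℝ≥0∞ := ENNReal.ofReal (a / t) * gammaPDF (2 * t) r (t - a)

lemma measurable_progenyPDF (r : ℝ) : Measurable (fun z : ℝ × ℝ => progenyPDF r z.1 z.2) := by
  unfold progenyPDF
  have h1 : Measurable (fun z : ℝ × ℝ => ENNReal.ofReal (z.1 / z.2)) := by fun_prop
  have h2 : Measurable (fun z : ℝ × ℝ => (2 * z.2, z.2 - z.1)) := by fun_prop
  exact h1.mul ((measurable_gammaPDF_uncurry r).comp h2)

/-- The Laplace transform of the total progeny density. -/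
def progenyLaplace (r s a : ℝ) : ℝ≥0∞ :=
  ∫⁻ t, ENNReal.ofReal (Real.exp (-(s * t))) * progenyPDF r a t

lemma measurable_progenyLaplace (r s : ℝ) : Measurable (progenyLaplace r s) := by
  unfold progenyLaplace
  have h : Measurable (fun z : ℝ × ℝ =>
      ENNReal.ofReal (Real.exp (-(s * z.2))) * progenyPDF r z.1 z.2) :=
    Measurable.mul (by fun_prop) (measurable_progenyPDF r)
  exact h.lintegral_prod_right'

/-- Continuous counterpart of `borelMass_add`. For `w > 0`, the factor `y / w` raises the shape `2
a` to `2 a + 1`, convolution gives shape `2 (a + w) + 1`, and undoing the size bias at `w` returns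
to `2 (a + w)`. For `w < 0` both sides vanish. -/
lemma lintegral_gammaPDF_mul_progenyPDF {a r w : ℝ} (ha : 0 < a) (hr : 0 < r) (hw : w ≠ 0) :
    ∫⁻ y, gammaPDF (2 * a) r y * progenyPDF r y w = progenyPDF r a (a + w) := by
  unfold progenyPDF
  rw [add_sub_cancel_left]
  rcases lt_or_gt_of_ne hw with h | hw
  · rw [gammaPDF_of_neg h, mul_zero, lintegral_eq_zero_iff']
    · filter_upwards [ae_ne_real 0] with y hy
      rcases lt_or_gt_of_ne hy with h' | h'
      · simp [gammaPDF_of_neg h']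
      · simp [gammaPDF_of_neg (show w - y < 0 by linarith)]
    · refine Measurable.aemeasurable ?_
      unfold gammaPDF
      fun_prop
  have h1 : ∀ᵐ y : ℝ, gammaPDF (2 * a) r y * (ENNReal.ofReal (y / w) * gammaPDF (2 * w) r (w - y))
      = ENNReal.ofReal (2 * a / r / w) *
        (gammaPDF (2 * a + 1) r y * gammaPDF (2 * w) r (w - y)) := by
    filter_upwards [ae_ne_real 0] with y hy
    have h2 := ofReal_mul_gammaPDF (c := 2 * a) (by positivity) hr hy
    rw [ENNReal.ofReal_div_of_pos hw, ENNReal.ofReal_div_of_pos hw, div_eq_mul_inv,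
      div_eq_mul_inv]
    calc _ = (ENNReal.ofReal y * gammaPDF (2 * a) r y) * (ENNReal.ofReal w)⁻¹ *
          gammaPDF (2 * w) r (w - y) := by ring
      _ = _ := by rw [h2]; ring
  have h3 := ofReal_mul_gammaPDF (c := 2 * (a + w)) (by positivity) hr hw.ne'
  rw [lintegral_congr_ae h1, lintegral_const_mul _ (by unfold gammaPDF; fun_prop),
    lintegral_gammaPDF_mul_gammaPDF (by positivity) (by positivity) hr hw,
    show 2 * a + 1 + 2 * w = 2 * (a + w) + 1 by ring,
    show 2 * a / r / w = a / (a + w) / w * (2 * (a + w) / r) by field_simp,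
    ENNReal.ofReal_mul (by positivity), mul_assoc, ← h3, ← mul_assoc,
    ← ENNReal.ofReal_mul (by positivity)]
  congr 2
  field_simp

lemma progenyLaplace_eq_shift (r s a : ℝ) : progenyLaplace r s a =
    ∫⁻ w, ENNReal.ofReal (Real.exp (-(s * (a + w)))) * progenyPDF r a (a + w) := by
  rw [progenyLaplace, ← lintegral_add_left_eq_self _ a]

/-- The branching equation for the Laplace transform of the total progeny density. -/
lemma lintegral_progenyLaplace_gammaLaw {p s a : ℝ} (hp : 0 < p) (ha : 0 < a) :
    ∫⁻ y, progenyLaplace (1 / p) s y ∂(gammaLaw (2 * a) p) =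
      ENNReal.ofReal (Real.exp (s * a)) * progenyLaplace (1 / p) s a := by
  have hr : 0 < 1 / p := by positivity
  have hm1 : Measurable (gammaPDF (2 * a) (1 / p)) := by unfold gammaPDF; fun_prop
  have hm2 : Measurable (fun z : ℝ × ℝ => gammaPDF (2 * a) (1 / p) z.1 *
      (ENNReal.ofReal (Real.exp (-(s * z.2))) * progenyPDF (1 / p) z.1 z.2)) :=
    (hm1.comp measurable_fst).mul (Measurable.mul (by fun_prop) (measurable_progenyPDF _))
  rw [gammaLaw, if_pos (by positivity), gammaMeasure,
    lintegral_withDensity_eq_lintegral_mul _ hm1 (measurable_progenyLaplace _ _)]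
  simp only [Pi.mul_apply]
  calc _ = ∫⁻ y, ∫⁻ w, gammaPDF (2 * a) (1 / p) y *
        (ENNReal.ofReal (Real.exp (-(s * w))) * progenyPDF (1 / p) y w) := by
        refine lintegral_congr fun y => ?_
        rw [progenyLaplace, lintegral_const_mul]
        exact Measurable.mul (by fun_prop)
          ((measurable_progenyPDF _).comp (measurable_prodMk_left (x := y)))
    _ = ∫⁻ w, ∫⁻ y, gammaPDF (2 * a) (1 / p) y *
        (ENNReal.ofReal (Real.exp (-(s * w))) * progenyPDF (1 / p) y w) :=
        lintegral_lintegral_swap hm2.aemeasurable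
    _ = ∫⁻ w, ENNReal.ofReal (Real.exp (s * a)) * (ENNReal.ofReal (Real.exp (-(s * (a + w)))) *
        progenyPDF (1 / p) a (a + w)) := by
        refine lintegral_congr_ae ?_
        filter_upwards [ae_ne_real 0] with w hw
        rw [← lintegral_gammaPDF_mul_progenyPDF ha hr hw, ← mul_assoc,
          ← ENNReal.ofReal_mul (Real.exp_nonneg _), ← Real.exp_add,
          show s * a + -(s * (a + w)) = -(s * w) by ring, ← lintegral_const_mul]
        · refine lintegral_congr fun y => ?_
          ring
        · exact hm1.mul ((measurable_progenyPDF _).comp (measurable_prodMk_right (y := w)))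
    _ = _ := by
        rw [progenyLaplace_eq_shift, lintegral_const_mul]
        have h1 : Measurable (fun w => ENNReal.ofReal (Real.exp (-(s * (a + w))))) := by fun_prop
        have h2 : Measurable (fun w => (a, a + w)) := by fun_prop
        exact h1.mul ((measurable_progenyPDF _).comp h2)

/-! ### Bounds for the Laplace transform of the total progeny density -/

/-- Truncate the Gamma integral to `(u, ∞)`, where `y ^ x ≥ u ^ x`. -/
lemma rpow_mul_exp_neg_le_Gamma {u x : ℝ} (hu : 0 < u) (hx : 0 ≤ x) :
    u ^ x * Real.exp (-u) ≤ Real.Gamma (x + 1) := by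
  have hint := Real.GammaIntegral_convergent (show 0 < x + 1 by linarith)
  rw [Real.Gamma_eq_integral (by linarith), ← integral_exp_neg_Ioi u, ← integral_const_mul]
  rw [add_sub_cancel_right] at hint ⊢
  calc _ ≤ ∫ y in Ioi u, Real.exp (-y) * y ^ x := by
        refine setIntegral_mono_on ?_ (hint.mono_set (Ioi_subset_Ioi hu.le)) measurableSet_Ioi
          fun y hy => ?_
        · exact (integrableOn_exp_neg_Ioi u).const_mul _
        · rw [mul_comm]
          have : u ≤ y := le_of_lt hy
          gcongr
    _ ≤ _ := by
        refine setIntegral_mono_set hint ?_ (Ioi_subset_Ioi hu.le).eventuallyLE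
        refine (ae_restrict_iff' measurableSet_Ioi).2 (ae_of_all _ fun y (hy : 0 < y) => ?_)
        simp only [Pi.zero_apply]
        positivity

/-- The factor of the Laplace integrand that stays regular at the origin. -/
def laplaceFactor (c r a u : ℝ) : ℝ :=
  Real.exp (-(c * (a + u))) * u ^ (2 * u) * Real.exp (-(r * u)) / Real.Gamma (2 * (a + u) + 1)

/-- Writing `Γ (2 t + 1) = 2 t Γ (2 t)` with `t = a + u` absorbs the factor `1 / t`, and `r ^ (2 t)`
is absorbed by shifting `s` to `s - 2 log r`. The only singular factor left, `2 a u ^ (2 a - 1)`, is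
the derivative of `u ^ (2 a)`. -/
lemma laplace_integrand_eq {r s a u : ℝ} (hr : 0 < r) (ha : 0 < a) (hu : 0 < u) :
    ENNReal.ofReal (Real.exp (-(s * (a + u)))) * progenyPDF r a (a + u) =
      ENNReal.ofReal (2 * a * u ^ (2 * a - 1)) *
        ENNReal.ofReal (laplaceFactor (s - 2 * Real.log r) r a u) := by
  have hau : 0 < a + u := by positivity
  have hG := Real.Gamma_pos_of_pos (show 0 < 2 * (a + u) by positivity)
  rw [progenyPDF, add_sub_cancel_left, gammaPDF_of_nonneg hu.le,
    ← ENNReal.ofReal_mul (by positivity), ← ENNReal.ofReal_mul (by positivity),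
    ← ENNReal.ofReal_mul (by positivity)]
  congr 1
  have h1 : Real.exp (-((s - 2 * Real.log r) * (a + u))) =
      Real.exp (-(s * (a + u))) * r ^ (2 * (a + u)) := by
    rw [Real.rpow_def_of_pos hr, ← Real.exp_add]
    congr 1
    ring
  rw [laplaceFactor, h1, Real.Gamma_add_one (by positivity),
    show 2 * (a + u) - 1 = (2 * a - 1) + 2 * u by ring, Real.rpow_add hu]
  field_simp

lemma laplaceFactor_le {c r a u : ℝ} (hc : 0 ≤ c) (hr : 0 ≤ r) (ha : 0 < a) (hu : 0 < u)
    (hu1 : u ≤ 1) : laplaceFactor c r a u ≤ Real.exp 1 := by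
  have hG := Real.Gamma_pos_of_pos (show 0 < 2 * (a + u) + 1 by positivity)
  have h1 := rpow_mul_exp_neg_le_Gamma one_pos (show 0 ≤ 2 * (a + u) by positivity)
  rw [Real.one_rpow, one_mul] at h1
  rw [laplaceFactor, div_le_iff₀ hG]
  have h2 : Real.exp (-(c * (a + u))) ≤ 1 := Real.exp_le_one_iff.2 (by
    have : 0 ≤ c * (a + u) := by positivity
    linarith)
  have h3 : Real.exp (-(r * u)) ≤ 1 := Real.exp_le_one_iff.2 (by
    have : 0 ≤ r * u := by positivity
    linarith)
  have h4 : u ^ (2 * u) ≤ 1 := Real.rpow_le_one hu.le hu1 (by positivity)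
  calc _ ≤ (1 : ℝ) * 1 * 1 := by gcongr
    _ = Real.exp 1 * Real.exp (-1) := by rw [← Real.exp_add]; simp
    _ ≤ _ := by gcongr

/-- The quotient `u ^ (2 (a + u)) / Γ (2 (a + u) + 1)` is at most `exp u`, so `c ≥ 2` leaves a spare
`exp (-u)` for integrability. The prefactor `2 a` makes the tail vanish with `a`. -/
lemma rpow_mul_laplaceFactor_le {c r a u : ℝ} (hc : 2 ≤ c) (hr : 0 ≤ r) (ha : 0 < a)
    (hu : 1 ≤ u) :
    2 * a * u ^ (2 * a - 1) * laplaceFactor c r a u ≤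
      2 * a * Real.exp (-(2 * a)) * Real.exp (-u) := by
  have hu0 : 0 < u := by linarith
  have hG := Real.Gamma_pos_of_pos (show 0 < 2 * (a + u) + 1 by positivity)
  have h1 := rpow_mul_exp_neg_le_Gamma hu0 (show 0 ≤ 2 * (a + u) by positivity)
  have h2 : Real.exp (-(c * (a + u))) ≤ Real.exp (-(2 * (a + u))) := by
    gcongr
  have h3 : Real.exp (-(r * u)) ≤ 1 := Real.exp_le_one_iff.2 (by
    have : 0 ≤ r * u := by positivity
    linarith)
  have h4 : u ^ (2 * a - 1) * u ^ (2 * u) ≤ u ^ (2 * (a + u)) := by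
    rw [← Real.rpow_add hu0]
    exact Real.rpow_le_rpow_of_exponent_le hu (by linarith)
  have h5 : Real.exp (-(2 * (a + u))) = Real.exp (-(2 * a)) * Real.exp (-u) * Real.exp (-u) := by
    rw [← Real.exp_add, ← Real.exp_add]
    congr 1
    ring
  rw [laplaceFactor, ← mul_div_assoc, div_le_iff₀ hG]
  calc _ = 2 * a * Real.exp (-(c * (a + u))) * (u ^ (2 * a - 1) * u ^ (2 * u)) *
        Real.exp (-(r * u)) := by ring
    _ ≤ 2 * a * Real.exp (-(2 * (a + u))) * u ^ (2 * (a + u)) * 1 := by gcongr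
    _ = 2 * a * Real.exp (-(2 * a)) * Real.exp (-u) * (u ^ (2 * (a + u)) * Real.exp (-u)) := by
        rw [h5]; ring
    _ ≤ _ := by gcongr

/-- The part of the Laplace integral away from the origin. -/
def laplaceTail (c r a : ℝ) : ℝ≥0∞ := ∫⁻ u in Ici 1,
  ENNReal.ofReal (2 * a * u ^ (2 * a - 1)) * ENNReal.ofReal (laplaceFactor c r a u)

lemma laplaceTail_le {c r a : ℝ} (hc : 2 ≤ c) (hr : 0 ≤ r) (ha : 0 < a) :
    laplaceTail c r a ≤ ENNReal.ofReal (2 * a * Real.exp (-(2 * a))) := by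
  have hint : ∫⁻ u in Ici (1 : ℝ), ENNReal.ofReal (Real.exp (-u)) ≤ 1 := by
    rw [← restrict_Ioi_eq_restrict_Ici, ← ofReal_integral_eq_lintegral_ofReal
      (integrableOn_exp_neg_Ioi 1) (ae_of_all _ fun _ => (Real.exp_pos _).le),
      integral_exp_neg_Ioi]
    exact ENNReal.ofReal_le_one.2 (Real.exp_le_one_iff.2 (by norm_num))
  calc laplaceTail c r a ≤ ∫⁻ u in Ici (1 : ℝ), ENNReal.ofReal (2 * a * Real.exp (-(2 * a))) *
        ENNReal.ofReal (Real.exp (-u)) := by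
        refine setLIntegral_mono (by fun_prop) fun u hu => ?_
        have hu0 : 0 < u := lt_of_lt_of_le one_pos hu
        rw [← ENNReal.ofReal_mul (by positivity), ← ENNReal.ofReal_mul (by positivity)]
        exact ENNReal.ofReal_le_ofReal (rpow_mul_laplaceFactor_le hc hr ha hu)
    _ ≤ _ := by
        rw [lintegral_const_mul _ (by fun_prop)]
        exact mul_le_of_le_one_right' hint

/-- On `(0, 1)` substitute `v = u ^ (2 a)`: the singular factor becomes Lebesgue measure on a fixed
interval, ready for dominated convergence as `a` tends to `0`. -/
lemma progenyLaplace_eq_add {r s a : ℝ} (hr : 0 < r) (ha : 0 < a) :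
    progenyLaplace r s a =
      (∫⁻ v in Ioo 0 1, ENNReal.ofReal
        (laplaceFactor (s - 2 * Real.log r) r a (v ^ (1 / (2 * a))))) +
      laplaceTail (s - 2 * Real.log r) r a := by
  have himg : (fun u : ℝ => u ^ (2 * a)) '' Ioo 0 1 = Ioo 0 1 := by
    ext v
    constructor
    · rintro ⟨u, hu, rfl⟩
      exact ⟨Real.rpow_pos_of_pos hu.1 _, Real.rpow_lt_one hu.1.le hu.2 (by positivity)⟩
    · intro hv
      refine ⟨v ^ (1 / (2 * a)), ⟨Real.rpow_pos_of_pos hv.1 _,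
        Real.rpow_lt_one hv.1.le hv.2 (by positivity)⟩, ?_⟩
      simp only
      rw [← Real.rpow_mul hv.1.le, one_div_mul_cancel (by positivity), Real.rpow_one]
  have hinv : ∀ u : ℝ, 0 < u → (u ^ (2 * a)) ^ (1 / (2 * a)) = u := fun u hu => by
    rw [← Real.rpow_mul hu.le, mul_one_div_cancel (by positivity), Real.rpow_one]
  conv_rhs => rw [← himg]
  rw [lintegral_image_eq_lintegral_abs_deriv_mul (f' := fun u => 2 * a * u ^ (2 * a - 1))
    measurableSet_Ioo
    (fun u hu => (Real.hasDerivAt_rpow_const (Or.inl hu.1.ne')).hasDerivWithinAt)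
    (fun u hu v hv h => by rw [← hinv u hu.1, ← hinv v hv.1]; exact congrArg (· ^ (1 / (2 * a))) h)]
  have e : ∫⁻ u in Ioo 0 1, ENNReal.ofReal |2 * a * u ^ (2 * a - 1)| * ENNReal.ofReal
      (laplaceFactor (s - 2 * Real.log r) r a ((u ^ (2 * a)) ^ (1 / (2 * a)))) =
      ∫⁻ u in Ioo 0 1, ENNReal.ofReal (Real.exp (-(s * (a + u)))) * progenyPDF r a (a + u) := by
    refine setLIntegral_congr_fun measurableSet_Ioo fun u hu => ?_
    have h0 := hu.1
    rw [hinv u hu.1, abs_of_pos (by positivity), laplace_integrand_eq hr ha hu.1]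
  have e' : laplaceTail (s - 2 * Real.log r) r a =
      ∫⁻ u in Ici 1, ENNReal.ofReal (Real.exp (-(s * (a + u)))) * progenyPDF r a (a + u) := by
    refine setLIntegral_congr_fun measurableSet_Ici fun u hu => ?_
    rw [laplace_integrand_eq hr ha (lt_of_lt_of_le one_pos hu)]
  rw [e, e', ← lintegral_union measurableSet_Ici, Ioo_union_Ici_eq_Ioi one_pos,
    progenyLaplace_eq_shift, lintegral_eq_setLIntegral_of_ae measurableSet_Ioi]
  · filter_upwards [ae_ne_real 0] with u hu0 hu
    have : u < 0 := lt_of_le_of_ne (not_lt.1 hu) hu0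
    simp [progenyPDF, gammaPDF_of_neg this]
  · exact Set.disjoint_left.2 fun u h1 h2 => absurd h1.2 (not_lt.2 h2)

/-- Uniformity in `a` is the point: the bound dominates the whole sequence of expectations and kills
the contribution of infinite progeny. -/
lemma progenyLaplace_le {r s a : ℝ} (hr : 0 < r) (hs : 2 * Real.log r + 2 ≤ s) (ha : 0 < a) :
    progenyLaplace r s a ≤ ENNReal.ofReal (Real.exp 1) + 1 := by
  rw [progenyLaplace_eq_add hr ha]
  refine add_le_add ?_ ((laplaceTail_le (by linarith) hr.le ha).trans ?_)
  · calc _ ≤ ∫⁻ v in Ioo (0 : ℝ) 1, ENNReal.ofReal (Real.exp 1) := by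
          refine setLIntegral_mono measurable_const fun v hv => ENNReal.ofReal_le_ofReal ?_
          exact laplaceFactor_le (by linarith) hr.le ha (Real.rpow_pos_of_pos hv.1 _)
            (Real.rpow_le_one hv.1.le hv.2.le (by positivity))
      _ = _ := by simp
  · rw [ENNReal.ofReal_le_one, Real.exp_neg, ← div_eq_mul_inv, div_le_one (Real.exp_pos _)]
    linarith [Real.add_one_le_exp (2 * a)]

lemma tendsto_laplaceFactor (c r : ℝ) :
    Tendsto (fun z : ℝ × ℝ => laplaceFactor c r z.1 z.2) (𝓝[>] 0 ×ˢ 𝓝[>] 0) (𝓝 1) := by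
  have h1 : Tendsto (fun z : ℝ × ℝ => z.1) (𝓝[>] 0 ×ˢ 𝓝[>] 0) (𝓝 0) :=
    tendsto_fst.mono_right nhdsWithin_le_nhds
  have h2 : Tendsto (fun z : ℝ × ℝ => z.2) (𝓝[>] 0 ×ˢ 𝓝[>] 0) (𝓝 0) :=
    tendsto_snd.mono_right nhdsWithin_le_nhds
  have h3 : Tendsto (fun u : ℝ => u ^ (2 * u)) (𝓝[>] 0) (𝓝 1) := by
    have h := tendsto_log_mul_rpow_nhdsGT_zero one_pos
    simp only [Real.rpow_one] at h
    have := (Real.continuous_exp.tendsto _).comp (h.const_mul 2)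
    rw [mul_zero, Real.exp_zero] at this
    refine this.congr' ?_
    filter_upwards [self_mem_nhdsWithin] with u hu
    rw [Real.rpow_def_of_pos hu]
    simp only [Function.comp_apply]
    congr 1
    ring
  have h4 : Tendsto (fun z : ℝ × ℝ => Real.Gamma (2 * (z.1 + z.2) + 1)) (𝓝[>] 0 ×ˢ 𝓝[>] 0)
      (𝓝 1) := by
    have hc : ContinuousAt Real.Gamma 1 := (Real.differentiableAt_Gamma fun k => by
      have : (0 : ℝ) ≤ k := by positivity
      linarith).continuousAt
    have := ((h1.add h2).const_mul 2).add_const 1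
    simp only [add_zero, mul_zero, zero_add] at this
    have h := hc.tendsto.comp this
    rwa [Real.Gamma_one] at h
  have h5 := ((Real.continuous_exp.tendsto _).comp ((h1.add h2).const_mul c).neg)
  have h6 := ((Real.continuous_exp.tendsto _).comp (h2.const_mul r).neg)
  have := (((h5.mul (h3.comp tendsto_snd)).mul h6).div h4 one_ne_zero)
  simp only [add_zero, mul_zero, neg_zero, Real.exp_zero, mul_one, div_one] at this
  exact this

/-- The total progeny started from a vanishing mass vanishes. -/
lemma tendsto_progenyLaplace {r s : ℝ} (hr : 0 < r) (hs : 2 * Real.log r + 2 ≤ s) :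
    Tendsto (progenyLaplace r s) (𝓝[>] 0) (𝓝 1) := by
  have hpos : ∀ᶠ a : ℝ in 𝓝[>] 0, 0 < a := self_mem_nhdsWithin
  have h1 : Tendsto (fun a => ∫⁻ v in Ioo 0 1, ENNReal.ofReal
        (laplaceFactor (s - 2 * Real.log r) r a (v ^ (1 / (2 * a))))) (𝓝[>] 0)
      (𝓝 (∫⁻ v in Ioo (0 : ℝ) 1, 1)) := by
    have hG := measurable_realGamma
    refine tendsto_lintegral_filter_of_dominated_convergence
      (fun _ => ENNReal.ofReal (Real.exp 1)) (.of_forall fun a => ?_) ?_ (by simp) ?_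
    · unfold laplaceFactor
      fun_prop
    · filter_upwards [hpos] with a ha
      refine (ae_restrict_iff' measurableSet_Ioo).2 (ae_of_all _ fun v hv =>
        ENNReal.ofReal_le_ofReal ?_)
      exact laplaceFactor_le (by linarith) hr.le ha (Real.rpow_pos_of_pos hv.1 _)
            (Real.rpow_le_one hv.1.le hv.2.le (by positivity))
    · refine (ae_restrict_iff' measurableSet_Ioo).2 (ae_of_all _ fun v hv => ?_)
      rw [← ENNReal.ofReal_one]
      refine ENNReal.tendsto_ofReal ((tendsto_laplaceFactor _ r).comp
        (f := fun a : ℝ => (a, v ^ (1 / (2 * a)))) (tendsto_id.prodMk ?_))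
      refine tendsto_nhdsWithin_iff.2 ⟨?_, .of_forall fun a => Real.rpow_pos_of_pos hv.1 _⟩
      -- For fixed `v < 1` the exponent `1 / (2 a)` tends to infinity, so the point `u = v ^ (1 / (2
      -- a))` collapses to the origin.
      refine (tendsto_rpow_atTop_of_base_lt_one v (by linarith [hv.1]) hv.2).comp ?_
      have : Tendsto (fun a : ℝ => 1 / 2 * a⁻¹) (𝓝[>] 0) atTop :=
        tendsto_inv_nhdsGT_zero.const_mul_atTop (by norm_num)
      refine this.congr fun a => ?_
      ring
  have h2 : Tendsto (laplaceTail (s - 2 * Real.log r) r) (𝓝[>] 0) (𝓝 0) := by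
    have h : Tendsto (fun a : ℝ => ENNReal.ofReal (2 * a * Real.exp (-(2 * a)))) (𝓝[>] 0)
        (𝓝 0) := by
      have : ContinuousAt (fun a : ℝ => ENNReal.ofReal (2 * a * Real.exp (-(2 * a)))) 0 := by
        exact ENNReal.continuous_ofReal.continuousAt.comp (by fun_prop)
      have := this.tendsto.mono_left (nhdsWithin_le_nhds (s := Ioi 0))
      simpa using this
    refine tendsto_of_tendsto_of_tendsto_of_le_of_le' tendsto_const_nhds h
      (.of_forall fun _ => zero_le) ?_
    filter_upwards [hpos] with a ha
    exact laplaceTail_le (by linarith) hr.le ha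
  have h3 := h1.add h2
  rw [add_zero] at h3
  have e : ∫⁻ v in Ioo (0 : ℝ) 1, (1 : ℝ≥0∞) = 1 := by simp
  rw [e] at h3
  refine h3.congr' ?_
  filter_upwards [hpos] with a ha
  rw [progenyLaplace_eq_add hr ha]

/-! ### Uniqueness of Laplace transforms -/

section Laplace

open scoped NNReal BoundedContinuousFunction

/-- The bounded continuous functions on `[0, ∞)` that are polynomials in `exp (-x)`. -/
def expPolynomials : StarSubalgebra ℝ (ℝ≥0 →ᵇ ℝ) where
  carrier := {f | ∃ q : Polynomial ℝ, ∀ x, f x = q.eval (Real.exp (-(x : ℝ)))}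
  mul_mem' := by
    rintro f g ⟨q, hq⟩ ⟨q', hq'⟩
    exact ⟨q * q', fun x => by simp [hq, hq']⟩
  add_mem' := by
    rintro f g ⟨q, hq⟩ ⟨q', hq'⟩
    exact ⟨q + q', fun x => by simp [hq, hq']⟩
  algebraMap_mem' c := ⟨Polynomial.C c, fun x => by simp⟩
  star_mem' := by
    rintro f ⟨q, hq⟩
    exact ⟨q, fun x => by simp [hq]⟩

lemma separatesPoints_expPolynomials :
    (expPolynomials.map (BoundedContinuousFunction.toContinuousMapStarₐ ℝ)).SeparatesPoints := by
  intro x y hxy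
  let f : ℝ≥0 →ᵇ ℝ := BoundedContinuousFunction.ofNormedAddCommGroup
    (fun x : ℝ≥0 => Real.exp (-(x : ℝ))) (by fun_prop) 1 (fun x => by
      rw [Real.norm_eq_abs, Real.abs_exp]
      exact Real.exp_le_one_iff.2 (by simp))
  refine ⟨fun x => Real.exp (-(x : ℝ)), ⟨f.toContinuousMap, ?_, rfl⟩, ?_⟩
  · exact ⟨f, ⟨Polynomial.X, fun x => by simp [f]⟩, rfl⟩
  · intro h
    simp only [Real.exp_eq_exp, neg_inj] at h
    exact hxy (NNReal.coe_injective h)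

lemma integral_eval_exp {μ : Measure ℝ} [IsFiniteMeasure μ] (hμ : ∀ᵐ x ∂μ, 0 ≤ x)
    (q : Polynomial ℝ) :
    ∫ x, q.eval (Real.exp (-x)) ∂μ =
      ∑ k ∈ q.support, q.coeff k * ∫ x, Real.exp (-(k * x)) ∂μ := by
  have hint : ∀ k : ℕ, Integrable (fun x => Real.exp (-(k * x))) μ := fun k =>
    Integrable.of_bound (by fun_prop) 1 (hμ.mono fun x hx => by
      rw [Real.norm_eq_abs, Real.abs_exp]
      exact Real.exp_le_one_iff.2 (by
        have : 0 ≤ (k : ℝ) * x := by positivity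
        linarith))
  simp_rw [← integral_const_mul]
  rw [← integral_finsetSum _ fun k _ => (hint k).const_mul _]
  refine integral_congr_ae (ae_of_all _ fun x => ?_)
  simp only [Polynomial.eval_eq_sum, Polynomial.sum]
  refine Finset.sum_congr rfl fun k _ => ?_
  rw [← Real.exp_nat_mul, mul_neg]

/-- A finite measure on `[0, ∞)` is determined by its Laplace transform at the integers. -/
theorem ext_of_integral_exp_neg {μ ν : Measure ℝ} [IsFiniteMeasure μ] [IsFiniteMeasure ν]
    (hμ : ∀ᵐ x ∂μ, 0 ≤ x) (hν : ∀ᵐ x ∂ν, 0 ≤ x)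
    (h : ∀ k : ℕ, ∫ x, Real.exp (-(k * x)) ∂μ = ∫ x, Real.exp (-(k * x)) ∂ν) : μ = ν := by
  have hm : Measurable Real.toNNReal := measurable_real_toNNReal
  have hpoly : ∀ {κ : Measure ℝ} [IsFiniteMeasure κ], (∀ᵐ x ∂κ, 0 ≤ x) → ∀ q : Polynomial ℝ,
      ∫ x : ℝ≥0, q.eval (Real.exp (-(x : ℝ))) ∂(κ.map Real.toNNReal) =
        ∫ x, q.eval (Real.exp (-x)) ∂κ := by
    intro κ _ hκ q
    rw [integral_map hm.aemeasurable (by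
      have : Continuous fun x : ℝ≥0 => q.eval (Real.exp (-(x : ℝ))) := by fun_prop
      exact this.aestronglyMeasurable)]
    refine integral_congr_ae (hκ.mono fun x hx => ?_)
    simp only [Real.coe_toNNReal x hx]
  -- On `[0, ∞)` the polynomials in `exp (-x)` form a point-separating algebra of bounded continuous
  -- functions, hence determine a finite measure; their integrals are combinations of Laplace
  -- transforms at integers.
  have hmap : μ.map Real.toNNReal = ν.map Real.toNNReal := by
    refine ext_of_forall_mem_subalgebra_integral_eq_of_polish separatesPoints_expPolynomials ?_
    rintro g ⟨q, hq⟩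
    simp_rw [hq]
    rw [hpoly hμ, hpoly hν, integral_eval_exp hμ, integral_eval_exp hν]
    simp_rw [h]
  have hback : ∀ {κ : Measure ℝ}, (∀ᵐ x ∂κ, 0 ≤ x) →
      (κ.map Real.toNNReal).map (fun x : ℝ≥0 => (x : ℝ)) = κ := by
    intro κ hκ
    rw [Measure.map_map (by fun_prop) hm]
    conv_rhs => rw [← Measure.map_id (μ := κ)]
    exact Measure.map_congr (hκ.mono fun x hx => Real.coe_toNNReal x hx)
  rw [← hback hμ, ← hback hν, hmap]

/-- A measure on `[0, ∞)` is determined by its Laplace transform near infinity, if finite. -/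
theorem ext_of_lintegral_exp_neg {μ ν : Measure ℝ} (hμ : ∀ᵐ x ∂μ, 0 ≤ x) (hν : ∀ᵐ x ∂ν, 0 ≤ x)
    {s₀ : ℝ} (hfin : ∫⁻ x, ENNReal.ofReal (Real.exp (-(s₀ * x))) ∂μ ≠ ∞)
    (h : ∀ s, s₀ ≤ s → ∫⁻ x, ENNReal.ofReal (Real.exp (-(s * x))) ∂μ =
      ∫⁻ x, ENNReal.ofReal (Real.exp (-(s * x))) ∂ν) : μ = ν := by
  -- Tilting by `exp (-s₀ x)` makes both measures finite and moves the integer points to `s₀ + k`;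
  -- the density `exp (s₀ x)` undoes it.
  let w : ℝ → ℝ≥0∞ := fun x => ENNReal.ofReal (Real.exp (-(s₀ * x)))
  have hw : Measurable w := by fun_prop
  have hw' : Measurable fun x => ENNReal.ofReal (Real.exp (s₀ * x)) := by fun_prop
  have hback : ∀ κ : Measure ℝ, (κ.withDensity w).withDensity
      (fun x => ENNReal.ofReal (Real.exp (s₀ * x))) = κ := by
    intro κ
    rw [← withDensity_mul _ hw hw']
    conv_rhs => rw [← withDensity_one (μ := κ)]
    congr 1
    ext x
    simp only [Pi.mul_apply, w, Pi.one_apply]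
    rw [← ENNReal.ofReal_mul (Real.exp_nonneg _), ← Real.exp_add]
    simp
  have hfinμ : IsFiniteMeasure (μ.withDensity w) := isFiniteMeasure_withDensity hfin
  have hfinν : IsFiniteMeasure (ν.withDensity w) :=
    isFiniteMeasure_withDensity (by rw [← h s₀ le_rfl]; exact hfin)
  have hint : ∀ (κ : Measure ℝ) (k : ℕ), ∫ x, Real.exp (-(k * x)) ∂(κ.withDensity w) =
      (∫⁻ x, ENNReal.ofReal (Real.exp (-((s₀ + k) * x))) ∂κ).toReal := by
    intro κ k
    rw [integral_eq_lintegral_of_nonneg_ae (ae_of_all _ fun x => (Real.exp_pos _).le)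
      (by fun_prop), lintegral_withDensity_eq_lintegral_mul _ hw (by fun_prop)]
    congr 1
    refine lintegral_congr fun x => ?_
    simp only [Pi.mul_apply, w]
    rw [← ENNReal.ofReal_mul (Real.exp_nonneg _), ← Real.exp_add]
    congr 2
    ring
  rw [← hback μ, ← hback ν, ext_of_integral_exp_neg (μ := μ.withDensity w)
    (ν := ν.withDensity w)]
  · exact (withDensity_absolutelyContinuous μ w).ae_le hμ
  · exact (withDensity_absolutelyContinuous ν w).ae_le hν
  · intro k
    rw [hint, hint, h _ (by have : (0 : ℝ) ≤ k := by positivity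
                            linarith)]

end Laplace

/-! ### The total progeny of the Gamma branching process -/

section Continuous

variable {Ω : Type*} [MeasurableSpace Ω] {P : Measure Ω} {p : ℝ} {X : ℕ → Ω → ℝ}


lemma IsGammaBranchingProcess.measurable_cascadeSize (h : IsGammaBranchingProcess p X P) :
    Measurable (cascadeSize X) :=
  Measurable.tsum fun n => (h.measurable n).ennreal_ofReal

lemma gammaLaw_Iic_zero {k : ℝ} (hk : 0 < k) (θ : ℝ) : gammaLaw k θ (Iic 0) = 0 := by
  rw [gammaLaw, if_pos hk, gammaMeasure, withDensity_apply _ measurableSet_Iic,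
    ← restrict_Iio_eq_restrict_Iic]
  exact setLIntegral_eq_zero measurableSet_Iio fun x hx => gammaPDF_of_neg hx

variable [IsProbabilityMeasure P]

/-- Averages of functionals of a history and the next generation. -/
lemma IsGammaBranchingProcess.lintegral_step (h : IsGammaBranchingProcess p X P) (hp : 0 < p)
    (n : ℕ) {F : (Fin (n + 1) → ℝ) × ℝ → ℝ≥0∞} (hF : Measurable F) :
    ∫⁻ ω, F (fun i => X i ω, X (n + 1) ω) ∂P =
      ∫⁻ ω, ∫⁻ y, F (fun i => X i ω, y) ∂(gammaLaw (2 * X n ω) p) ∂P := by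
  have := isMarkovKernel_gammaStep hp n
  have hX : Measurable fun ω (i : Fin (n + 1)) => X i ω :=
    measurable_pi_lambda _ fun i => h.measurable i
  have hmap := (h.step n).map_eq
  have h1 : ∫⁻ ω, F (fun i => X i ω, X (n + 1) ω) ∂P =
      ∫⁻ z, F z ∂(P.map fun ω => ((fun (i : Fin (n + 1)) => X i ω), X (n + 1) ω)) :=
    (lintegral_map hF (hX.prodMk (h.measurable _))).symm
  rw [h1, hmap, Measure.lintegral_compProd hF, lintegral_map _ hX]
  · rfl
  · exact hF.lintegral_kernel_prod_right'

/-- Positivity keeps the process off the degenerate point-mass branch of `gammaLaw`, where the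
branching equation for `progenyLaplace` is not available. -/
lemma IsGammaBranchingProcess.ae_pos (h : IsGammaBranchingProcess p X P) (hp : 0 < p) (n : ℕ) :
    ∀ᵐ ω ∂P, 0 < X n ω := by
  induction n with
  | zero => exact h.start.mono fun ω hω => by simp [hω]
  | succ n ih =>
    have h1 := h.lintegral_step hp n (F := fun z => (Iic (0 : ℝ)).indicator 1 z.2)
      ((measurable_one.indicator measurableSet_Iic).comp measurable_snd)
    have h2 : ∫⁻ ω, ∫⁻ y, (Iic (0 : ℝ)).indicator 1 y ∂(gammaLaw (2 * X n ω) p) ∂P = 0 := by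
      rw [lintegral_congr_ae (g := 0), Pi.zero_def, lintegral_zero]
      filter_upwards [ih] with ω hω
      rw [lintegral_indicator_one measurableSet_Iic, gammaLaw_Iic_zero (by linarith)]
      rfl
    have hm : Measurable fun ω => (Iic (0 : ℝ)).indicator (1 : ℝ → ℝ≥0∞) (X (n + 1) ω) :=
      (measurable_one.indicator measurableSet_Iic).comp (h.measurable (n + 1))
    rw [h2, lintegral_eq_zero_iff hm] at h1
    filter_upwards [h1] with ω hω
    by_contra hneg
    simp [not_lt.1 hneg] at hω

/-- Conditionally on the first generations, the remaining progeny has the Laplace transform of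
the total progeny density started from the present generation. -/
lemma IsGammaBranchingProcess.lintegral_exp_mul_progenyLaplace
    (h : IsGammaBranchingProcess p X P) (hp : 0 < p) (s : ℝ) (n : ℕ) :
    ∫⁻ ω, ENNReal.ofReal (Real.exp (-(s * ∑ k ∈ Finset.range n, X k ω))) *
      progenyLaplace (1 / p) s (X n ω) ∂P = progenyLaplace (1 / p) s 1 := by
  induction n with
  | zero =>
    have : ∫⁻ ω, progenyLaplace (1 / p) s (X 0 ω) ∂P = ∫⁻ _, progenyLaplace (1 / p) s 1 ∂P :=
      lintegral_congr_ae (h.start.mono fun ω hω => by simp [hω])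
    simpa using this
  | succ n ih =>
    have hL := measurable_progenyLaplace (1 / p) s
    have h1 := h.lintegral_step hp n (F := fun z =>
      ENNReal.ofReal (Real.exp (-(s * ∑ k, z.1 k))) * progenyLaplace (1 / p) s z.2) (by fun_prop)
    have hsum : ∀ ω, ∑ k : Fin (n + 1), X k ω = ∑ k ∈ Finset.range (n + 1), X k ω := fun ω =>
      Fin.sum_univ_eq_sum_range (fun k => X k ω) (n + 1)
    simp only [hsum] at h1
    rw [h1, ← ih]
    refine lintegral_congr_ae ?_
    filter_upwards [h.ae_pos hp n] with ω hω
    -- The factor `exp (s * X n ω)` from the branching equation cancels the last term of the partial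
    -- sum.
    rw [lintegral_const_mul _ hL, lintegral_progenyLaplace_gammaLaw hp hω, ← mul_assoc,
      ← ENNReal.ofReal_mul (Real.exp_nonneg _), ← Real.exp_add, Finset.sum_range_succ]
    congr 3
    ring

/-- A pathwise dichotomy. If the series diverges, the exponential tends to `0` against a bounded
factor; if it converges, its terms tend to `0` from the right and `progenyLaplace` tends to `1`. -/
lemma tendsto_exp_mul_progenyLaplace {r s : ℝ} (hr : 0 < r) (hs : 2 * Real.log r + 2 ≤ s)
    (hs0 : 0 < s) {x : ℕ → ℝ} (hx : ∀ n, 0 < x n) :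
    Tendsto (fun n => ENNReal.ofReal (Real.exp (-(s * ∑ k ∈ Finset.range n, x k))) *
      progenyLaplace r s (x n)) atTop
      (𝓝 (if ∑' n, ENNReal.ofReal (x n) = ∞ then 0 else
        ENNReal.ofReal (Real.exp (-(s * (∑' n, ENNReal.ofReal (x n)).toReal))))) := by
  have hsum : ∀ n, ∑ k ∈ Finset.range n, ENNReal.ofReal (x k) =
      ENNReal.ofReal (∑ k ∈ Finset.range n, x k) := fun n =>
    (ENNReal.ofReal_sum_of_nonneg fun k _ => (hx k).le).symm
  have hlim := ENNReal.tendsto_nat_tsum fun n => ENNReal.ofReal (x n)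
  have hbound : ∀ n, progenyLaplace r s (x n) ≤ ENNReal.ofReal (Real.exp 1) + 1 := fun n =>
    progenyLaplace_le hr hs (hx n)
  split_ifs with hZ
  · rw [hZ] at hlim
    simp only [hsum] at hlim
    have hS : Tendsto (fun n => ∑ k ∈ Finset.range n, x k) atTop atTop :=
      ENNReal.tendsto_ofReal_nhds_top.1 hlim
    have h1 : Tendsto (fun n => ENNReal.ofReal (Real.exp (-(s * ∑ k ∈ Finset.range n, x k))) *
        (ENNReal.ofReal (Real.exp 1) + 1)) atTop (𝓝 0) := by
      have h2 := ENNReal.tendsto_ofReal (Real.tendsto_exp_neg_atTop_nhds_zero.comp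
        (hS.const_mul_atTop hs0))
      rw [ENNReal.ofReal_zero] at h2
      have h3 := ENNReal.Tendsto.mul_const (b := ENNReal.ofReal (Real.exp 1) + 1) h2
        (Or.inr (by simp))
      rwa [zero_mul] at h3
    exact tendsto_of_tendsto_of_tendsto_of_le_of_le tendsto_const_nhds h1 (fun _ => zero_le)
      fun n => mul_le_mul_right (hbound n) _
  · have hS : Tendsto (fun n => ∑ k ∈ Finset.range n, x k) atTop
        (𝓝 (∑' n, ENNReal.ofReal (x n)).toReal) := by
      refine ((ENNReal.tendsto_toReal hZ).comp hlim).congr fun n => ?_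
      simp only [Function.comp_apply, hsum]
      exact ENNReal.toReal_ofReal (Finset.sum_nonneg fun k _ => (hx k).le)
    have hx0 : Tendsto x atTop (𝓝[>] 0) := by
      refine tendsto_nhdsWithin_iff.2 ⟨?_, .of_forall hx⟩
      have := (hS.comp (tendsto_add_atTop_nat 1)).sub hS
      rw [sub_self] at this
      refine this.congr fun n => ?_
      simp [Finset.sum_range_succ]
    have h1 := ENNReal.tendsto_ofReal ((Real.continuous_exp.tendsto _).comp (hS.const_mul s).neg)
    have h2 := (tendsto_progenyLaplace hr hs).comp hx0
    have h3 := ENNReal.Tendsto.mul h1 (Or.inr ENNReal.one_ne_top) h2 (Or.inr ENNReal.ofReal_ne_top)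
    rw [mul_one] at h3
    exact h3

/-- The Laplace transform of the total progeny. -/
lemma IsGammaBranchingProcess.lintegral_exp_cascadeSize (h : IsGammaBranchingProcess p X P)
    (hp : 0 < p) {s : ℝ} (hs : 2 * Real.log (1 / p) + 2 ≤ s) (hs0 : 0 < s) :
    ∫⁻ ω, (if cascadeSize X ω = ∞ then 0 else
      ENNReal.ofReal (Real.exp (-(s * (cascadeSize X ω).toReal)))) ∂P =
      progenyLaplace (1 / p) s 1 := by
  have hr : 0 < 1 / p := by positivity
  have hpos : ∀ᵐ ω ∂P, ∀ n, 0 < X n ω := ae_all_iff.2 fun n => h.ae_pos hp n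
  have hX := h.measurable
  have hL := measurable_progenyLaplace (1 / p) s
  have hlim := tendsto_lintegral_of_dominated_convergence (μ := P)
    (F := fun n ω => ENNReal.ofReal (Real.exp (-(s * ∑ k ∈ Finset.range n, X k ω))) *
      progenyLaplace (1 / p) s (X n ω))
    (f := fun ω => if cascadeSize X ω = ∞ then 0 else
      ENNReal.ofReal (Real.exp (-(s * (cascadeSize X ω).toReal))))
    (fun _ => ENNReal.ofReal (Real.exp 1) + 1) (fun n => by fun_prop)
    (fun n => hpos.mono fun ω hω => by
      refine (mul_le_of_le_one_left' (ENNReal.ofReal_le_one.2 (Real.exp_le_one_iff.2 ?_))).trans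
        (progenyLaplace_le hr hs (hω n))
      have : 0 ≤ s * ∑ k ∈ Finset.range n, X k ω :=
        mul_nonneg hs0.le (Finset.sum_nonneg fun k _ => (hω k).le)
      linarith) (by simp)
    (hpos.mono fun ω hω => tendsto_exp_mul_progenyLaplace hr hs hs0 hω)
  simp only [h.lintegral_exp_mul_progenyLaplace hp] at hlim
  exact tendsto_nhds_unique hlim tendsto_const_nhds

lemma progenyPDF_one_eq {x : ℝ} (hp : 0 < p) (hx : 1 < x) :
    progenyPDF (1 / p) 1 x = ENNReal.ofReal (cascadeDensity p x) := by
  have h : 0 < x - 1 := by linarith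
  have hG := (Real.Gamma_pos_of_pos (show 0 < 2 * x by linarith))
  rw [progenyPDF, gammaPDF_of_nonneg h.le, ← ENNReal.ofReal_mul (by positivity),
    cascadeDensity_eq hp hx, Real.div_rpow h.le hp.le, Real.div_rpow zero_le_one hp.le,
    Real.one_rpow, Real.rpow_sub_one h.ne',
    show -(1 / p * (x - 1)) = -(x - 1) / p by ring]
  congr 1
  field_simp

/-- The law of the total progeny of the Gamma branching process, restricted to extinction. -/
theorem IsGammaBranchingProcess.map_cascadeSize (h : IsGammaBranchingProcess p X P)
    (hp : 0 < p) :
    (P.restrict {ω | cascadeSize X ω ≠ ∞}).map (fun ω => (cascadeSize X ω).toReal) =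
      volume.withDensity (progenyPDF (1 / p) 1) := by
  have hZ := h.measurable_cascadeSize
  have hfinset : MeasurableSet {ω | cascadeSize X ω ≠ ∞} :=
    (hZ (measurableSet_singleton ∞)).compl
  have hpdf : Measurable (progenyPDF (1 / p) 1) :=
    (measurable_progenyPDF (1 / p)).comp measurable_prodMk_left
  have hμ : ∀ s : ℝ, ∫⁻ x, ENNReal.ofReal (Real.exp (-(s * x)))
      ∂((P.restrict {ω | cascadeSize X ω ≠ ∞}).map fun ω => (cascadeSize X ω).toReal) =
      ∫⁻ ω, (if cascadeSize X ω = ∞ then 0 else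
        ENNReal.ofReal (Real.exp (-(s * (cascadeSize X ω).toReal)))) ∂P := by
    intro s
    rw [lintegral_map (by fun_prop) hZ.ennreal_toReal, ← lintegral_indicator hfinset]
    refine lintegral_congr fun ω => ?_
    by_cases hω : cascadeSize X ω = ∞ <;> simp [hω]
  have hν : ∀ s : ℝ, ∫⁻ x, ENNReal.ofReal (Real.exp (-(s * x)))
      ∂(volume.withDensity (progenyPDF (1 / p) 1)) = progenyLaplace (1 / p) s 1 := by
    intro s
    rw [lintegral_withDensity_eq_lintegral_mul _ hpdf (by fun_prop), progenyLaplace]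
    exact lintegral_congr fun x => mul_comm (progenyPDF (1 / p) 1 x) _
  -- The first entry makes `progenyLaplace` bounded; the second keeps `s` positive, so that infinite
  -- progeny contributes nothing.
  have hs0 : 0 < max (2 * Real.log (1 / p) + 2) 1 := lt_max_of_lt_right one_pos
  refine ext_of_lintegral_exp_neg (s₀ := max (2 * Real.log (1 / p) + 2) 1) ?_ ?_ ?_ ?_
  · rw [ae_map_iff hZ.ennreal_toReal.aemeasurable measurableSet_Ici]
    exact ae_of_all _ fun ω => ENNReal.toReal_nonneg
  · rw [ae_withDensity_iff hpdf]
    refine ae_of_all _ fun x hx => ?_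
    by_contra hneg
    exact hx (by simp [progenyPDF, gammaPDF_of_neg (show x - 1 < 0 by linarith)])
  · rw [hμ, h.lintegral_exp_cascadeSize hp (le_max_left _ _) hs0]
    exact ((progenyLaplace_le (by positivity) (le_max_left _ _) one_pos).trans_lt
      (by simp)).ne
  · intro s hs
    rw [hμ, hν, h.lintegral_exp_cascadeSize hp ((le_max_left _ _).trans hs) (hs0.trans_le hs)]

/-- The total progeny of the Gamma branching process has the cascade density. -/
theorem IsGammaBranchingProcess.measure_cascadeSize (h : IsGammaBranchingProcess p X P)
    (hp : 0 < p) {B : Set ℝ} (hB : MeasurableSet B) :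
    P {ω | cascadeSize X ω ≠ ∞ ∧ (cascadeSize X ω).toReal ∈ B} =
      ∫⁻ x in B ∩ Ioi 1, ENNReal.ofReal (cascadeDensity p x) := by
  have hZ := h.measurable_cascadeSize
  have h1 := congrArg (fun μ : Measure ℝ => μ B) (h.map_cascadeSize hp)
  rw [Measure.map_apply hZ.ennreal_toReal hB, Measure.restrict_apply (hZ.ennreal_toReal hB),
    withDensity_apply _ hB] at h1
  have h2 : {ω | cascadeSize X ω ≠ ∞ ∧ (cascadeSize X ω).toReal ∈ B} =
      (fun ω => (cascadeSize X ω).toReal) ⁻¹' B ∩ {ω | cascadeSize X ω ≠ ∞} := by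
    ext ω
    exact and_comm
  rw [h2, h1, ← setLIntegral_congr_fun (hB.inter measurableSet_Ioi)
      (fun x hx => progenyPDF_one_eq hp hx.2), inter_comm, ← Measure.restrict_restrict
      measurableSet_Ioi, ← lintegral_indicator measurableSet_Ioi]
  refine lintegral_congr_ae (ae_restrict_of_ae ?_)
  filter_upwards [ae_ne_real 1] with x hx
  by_cases hx1 : 1 < x
  · simp [hx1]
  · have : x - 1 < 0 := sub_neg.2 (lt_of_le_of_ne (not_lt.1 hx1) hx)
    simp [hx1, progenyPDF, gammaPDF_of_neg this]

end Continuous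

end GammaCascade

end

/-! ### The three statements together -/

open GammaCascade in
theorem mainTheorem1 (p : ℝ) (hp : 0 < p) :
    -- the total progeny of the Gamma branching process has density `g` on `(1, ∞)`
    (∀ (Ω : Type*) [MeasurableSpace Ω] (P : Measure Ω) [IsProbabilityMeasure P]
        (X : ℕ → Ω → ℝ), IsGammaBranchingProcess p X P →
      ∀ B : Set ℝ, MeasurableSet B →
        P {ω | cascadeSize X ω ≠ ∞ ∧ (cascadeSize X ω).toReal ∈ B} =
          ∫⁻ x in B ∩ Ioi 1, ENNReal.ofReal (cascadeDensity p x)) ∧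
    -- the exact total-progeny law of the approximating discrete branching processes
    (∀ (δ : ℝ), 0 < δ → δ < p →
      ∀ (Ω : Type*) [MeasurableSpace Ω] (P : Measure Ω) [IsProbabilityMeasure P]
        (ξ : ℕ → ℕ → Ω → ℕ), IsAtomicOffspring p δ ξ P →
      ∀ m n : ℕ, 1 ≤ m → m ≤ n →
        P {ω | totalProgeny ξ m ω = n} = ENNReal.ofReal (progenyMass p δ m n)) ∧
    -- the density is the limit of the rescaled discrete laws as the mesh `δ = 1 / m` tends to zero
    (∀ (Ω : ℕ → Type*) [∀ m, MeasurableSpace (Ω m)] (P : ∀ m, Measure (Ω m))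
        [∀ m, IsProbabilityMeasure (P m)] (ξ : ∀ m, ℕ → ℕ → Ω m → ℕ),
      (∀ m : ℕ, 0 < m → 1 / (m : ℝ) < p → IsAtomicOffspring p (1 / m) (ξ m) (P m)) →
      ∀ x : ℝ, 1 < x →
        Tendsto (fun m : ℕ => (m : ℝ) *
            (P m).real {ω | totalProgeny (ξ m) m ω = (⌊m * x⌋₊ : ℕ)}) atTop
          (𝓝 (cascadeDensity p x))) := by
  refine ⟨fun Ω _ P _ X h B hB => h.measure_cascadeSize hp hB,
    fun δ hδ hδp Ω _ P _ ξ h m n hm hmn => ?_, fun Ω _ P _ ξ h x hx => ?_⟩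
  · rw [h.measure_totalProgeny_eq (atomicR_pos hδ hδp) (atomicQ_nonneg hδ hδp)
      (atomicQ_lt_one hδ hδp) (hm.trans hmn) hmn,
      progenyMass_eq_borelMass (atomicR_pos hδ hδp) (hm.trans hmn) hmn]
  · refine (tendsto_borelMass hp hx).congr' ?_
    -- The exact law is available only for mesh `1 / m < p`, which holds for all large `m`.
    filter_upwards [eventually_gt_atTop 0,
      (tendsto_one_div_atTop_nhds_zero_nat (𝕜 := ℝ)).eventually_lt_const hp] with m hm hmp
    have hm' : (0 : ℝ) < m := by exact_mod_cast hm
    have hδ : 0 < 1 / (m : ℝ) := by positivity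
    have hmn : m ≤ ⌊(m : ℝ) * x⌋₊ := Nat.le_floor (by nlinarith)
    rw [measureReal_def, (h m hm hmp).measure_totalProgeny_eq (atomicR_pos hδ hmp)
      (atomicQ_nonneg hδ hmp) (atomicQ_lt_one hδ hmp) (hm.trans_le hmn) hmn, ENNReal.toReal_ofReal
      (borelMass_nonneg (atomicR_pos hδ hmp).le (atomicQ_nonneg hδ hmp)
        (atomicQ_lt_one hδ hmp).le _ _)]
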